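/- Let $(n_k)_{k\ge1}$ be integers with $n_k\ge2$ and $(c_k)_{k\ge1}$ reals in $(0,1)$ with $(n_k-1)c_k<1$ for all $k$. Put $E_0=[0,1]$ and let $E_k$ be obtained from $E_{k-1}$ by deleting from every component $I$ of $E_{k-1}$ $n_k-1$ open intervals (gaps) of equal length $c_k|I|$ so that the remaining $n_k$ closed intervals have equal length; let $E=\bigcap_{k\ge0}E_k$ be the resulting uniform Cantor set. For a component $I_w$ of $E_{k-1}$, where $w=i_1\cdots i_{k-1}$ is a word with $1\le i_j\le n_j$ (and $I_w=[0,1]$ for the empty word), denote by $I_{w1},\dots,I_{wn_k}$, from left to right, the components of $E_k$ contained in $I_w$. Let $\delta_k=\prod_{i=1}^k\frac{1-(n_i-1)c_i}{n_i}$ be the length of a component of $E_k$, and $\varepsilon_k=c_k\delta_{k-1}$ the length of a gap of level $k$. Let $\Lambda=\{k\ge1:\varepsilon_k<\delta_k\}$ and, for $k\in\Lambda$, let $m_k$ be the unique positive integer with $\delta_{k+m_k}\le\varepsilon_k<\delta_{k+m_k-1}$. Let $\mathbb P=\{P_k\}_{k\ge1}$, $P_k=(p_{k,1},\dots,p_{k,n_k})$,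 be a sequence of vectors with positive entries and $\sum_{i=1}^{n_k}p_{k,i}=1$, and let $\mu_{\mathbb P}$ be the unique Borel probability measure on $E$ such that $\mu_{\mathbb P}(I_{wi})=p_{k,i}\,\mu_{\mathbb P}(I_w)$ for all $k\ge1$, all words $w$ of length $k-1$ and all $1\le i\le n_k$ (where $\mu_{\mathbb P}(I)$ means $\mu_{\mathbb P}(I\cap E)$). A measure $\mu$ on $E$ is called doubling if there is $C\ge1$ such that $0<\mu(B(x,2r))\le C\mu(B(x,r))<\infty$ for all $x\in E$ and $r>0$, where $B(x,r)$ is the open ball in $E$. Suppose $\sup_{k\ge1}n_k<\infty$. Then $\mu_{\mathbb P}$ is doubling on $E$ if and only if there is a constant $C>1$ such that (a) $C^{-1}p_{k,i}\le p_{k,i+1}\le Cp_{k,i}$ for all $k\ge1$ and $1\le i<n_k$, and (b) $C^{-1}\prod_{j=1}^tp_{k+j,1}\le\prod_{j=1}^tp_{k+j,n_{k+j}}\le C\prod_{j=1}^tp_{k+j,1}$ for all $k\in\Lambda$ and $1\le t<m_k$. -/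

import Mathlib

open MeasureTheory Filter Topology

/-- A measure `μ` on a metric space is doubling if there is `C ≥ 1` with
`0 < μ (B(x, 2r)) ≤ C μ (B(x, r)) < ∞` for all points `x` and all `r > 0`. -/
def IsDoubling {X : Type*} [MetricSpace X] [MeasurableSpace X] (μ : Measure X) : Prop :=
  ∃ C : ℝ, 1 ≤ C ∧ ∀ (x : X) (r : ℝ), 0 < r →
    0 < μ (Metric.ball x (2 * r)) ∧
    μ (Metric.ball x (2 * r)) ≤ ENNReal.ofReal C * μ (Metric.ball x r) ∧
    ENNReal.ofReal C * μ (Metric.ball x r) < ⊤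

/-- The data `(n_k)`, `(c_k)`, `k ≥ 1`, of a uniform Cantor set (values at index `0` are unused). -/
structure CantorData where
  n : ℕ → ℕ
  c : ℕ → ℝ
  two_le : ∀ k, 1 ≤ k → 2 ≤ n k
  c_pos : ∀ k, 1 ≤ k → 0 < c k
  c_lt_one : ∀ k, 1 ≤ k → c k < 1
  gaps_lt_one : ∀ k, 1 ≤ k → ((n k : ℝ) - 1) * c k < 1

namespace CantorData

/-- `δ_k`: the length of a component of level `k`. -/
noncomputable def δ (D : CantorData) (k : ℕ) : ℝ :=
  ∏ i ∈ Finset.Icc 1 k, (1 - ((D.n i : ℝ) - 1) * D.c i) / (D.n i : ℝ)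

/-- `ε_k = c_k δ_{k-1}`: the length of a gap of level `k ≥ 1`. -/
noncomputable def ε (D : CantorData) (k : ℕ) : ℝ := D.c k * D.δ (k - 1)

/-- The digits `w 1, …, w k` form a word of length `k`, that is, `1 ≤ w j ≤ n_j`. Words of length
`k` are represented by digit sequences of which only the entries `1, …, k` matter. -/
def IsWord (D : CantorData) (k : ℕ) (w : ℕ → ℕ) : Prop :=
  ∀ j, 1 ≤ j → j ≤ k → 1 ≤ w j ∧ w j ≤ D.n j

/-- The left endpoint of the component labelled by the word `w 1 ⋯ w k`: inside a component of
level `k`, the components of level `k + 1` are translates of each other by multiples of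
`δ_{k+1} + ε_{k+1}`, numbered `1, …, n_{k+1}` from left to right. -/
noncomputable def leftEnd (D : CantorData) (w : ℕ → ℕ) : ℕ → ℝ
  | 0 => 0
  | k + 1 => leftEnd D w k + ((w (k + 1) : ℝ) - 1) * (D.δ (k + 1) + D.ε (k + 1))

/-- The component of level `k` labelled by the word `w 1 ⋯ w k`. -/
noncomputable def component (D : CantorData) (w : ℕ → ℕ) (k : ℕ) : Set ℝ :=
  Set.Icc (D.leftEnd w k) (D.leftEnd w k + D.δ k)

/-- `E_k`, the union of the components of level `k`. -/
noncomputable def level (D : CantorData) (k : ℕ) : Set ℝ :=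
  ⋃ (w : ℕ → ℕ) (_ : D.IsWord k w), D.component w k

/-- The uniform Cantor set `E = ⋂ E_k`. -/
noncomputable def cantorSet (D : CantorData) : Set ℝ := ⋂ k : ℕ, D.level k

/-- `Λ`: the levels `k ≥ 1` at which gaps are shorter than components. -/
def Λ (D : CantorData) : Set ℕ := {k | 1 ≤ k ∧ D.ε k < D.δ k}

/-- The component of level `k` labelled by `w`, as a subset of `E`. -/
noncomputable def piece (D : CantorData) (w : ℕ → ℕ) (k : ℕ) : Set D.cantorSet :=
  Subtype.val ⁻¹' D.component w k

section basic

variable (D : CantorData)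

lemma ratio_pos (k : ℕ) (hk : 1 ≤ k) :
    0 < (1 - ((D.n k : ℝ) - 1) * D.c k) / (D.n k : ℝ) := by
  have h1 := D.gaps_lt_one k hk
  have h2 : (2 : ℝ) ≤ D.n k := by exact_mod_cast D.two_le k hk
  apply div_pos <;> linarith

lemma ratio_le (k : ℕ) (hk : 1 ≤ k) :
    (1 - ((D.n k : ℝ) - 1) * D.c k) / (D.n k : ℝ) ≤ 1 / 2 := by
  have h1 := D.c_pos k hk
  have h2 : (2 : ℝ) ≤ D.n k := by exact_mod_cast D.two_le k hk
  rw [div_le_div_iff₀ (by linarith) (by norm_num)]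
  nlinarith

lemma δ_zero : D.δ 0 = 1 := by simp [δ]

lemma δ_succ (k : ℕ) : D.δ (k + 1) =
    D.δ k * ((1 - ((D.n (k + 1) : ℝ) - 1) * D.c (k + 1)) / (D.n (k + 1) : ℝ)) := by
  unfold δ
  rw [Finset.prod_Icc_succ_top (by omega)]

lemma δ_pos (k : ℕ) : 0 < D.δ k :=
  Finset.prod_pos fun i hi => D.ratio_pos i (Finset.mem_Icc.1 hi).1

lemma δ_succ_le (k : ℕ) : D.δ (k + 1) ≤ D.δ k * (1 / 2) := by
  rw [δ_succ]
  exact mul_le_mul_of_nonneg_left (D.ratio_le _ (by omega)) (D.δ_pos k).le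

lemma δ_strictAnti : StrictAnti D.δ :=
  strictAnti_nat_of_succ_lt fun k => by
    have := D.δ_succ_le k
    have := D.δ_pos k
    linarith

lemma δ_tendsto : Tendsto D.δ atTop (𝓝 0) := by
  have h : ∀ k, D.δ k ≤ (1 / 2 : ℝ) ^ k := by
    intro k
    induction k with
    | zero => simp [δ_zero]
    | succ k ih =>
      have := D.δ_succ_le k
      rw [pow_succ]
      linarith
  exact squeeze_zero (fun k => (D.δ_pos k).le) h
    (tendsto_pow_atTop_nhds_zero_of_lt_one (by norm_num) (by norm_num))

lemma ε_pos (k : ℕ) (hk : 1 ≤ k) : 0 < D.ε k := mul_pos (D.c_pos k hk) (D.δ_pos _)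

/-- `n_{k+1}` components and `n_{k+1} - 1` gaps of level `k + 1` fill a component of level `k`. -/
lemma fill (k : ℕ) :
    (D.n (k + 1) : ℝ) * D.δ (k + 1) + ((D.n (k + 1) : ℝ) - 1) * D.ε (k + 1) = D.δ k := by
  have h2 : (2 : ℝ) ≤ D.n (k + 1) := by exact_mod_cast D.two_le (k + 1) (by omega)
  have h3 : (D.n (k + 1) : ℝ) ≠ 0 := by linarith
  rw [δ_succ]
  unfold ε
  rw [Nat.add_sub_cancel]
  field_simp
  ring

lemma component_zero (w : ℕ → ℕ) : D.component w 0 = Set.Icc 0 1 := by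
  simp [component, leftEnd, δ_zero]

/-- For `k ∈ Λ` there is a unique positive integer `m` with `δ_{k+m} ≤ ε_k < δ_{k+m-1}`. -/
theorem existsUnique_m (k : ℕ) (hk : k ∈ D.Λ) :
    ∃! m : ℕ, 1 ≤ m ∧ D.δ (k + m) ≤ D.ε k ∧ D.ε k < D.δ (k + m - 1) := by
  classical
  obtain ⟨hk1, hlt⟩ := hk
  have hex : ∃ m, D.δ (k + m) ≤ D.ε k := by
    have h := (D.δ_tendsto.eventually (gt_mem_nhds (D.ε_pos k hk1))).and (eventually_ge_atTop k)
    obtain ⟨N, hN, hkN⟩ := h.exists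
    exact ⟨N - k, by rw [Nat.add_sub_cancel' hkN]; exact hN.le⟩
  have h1 : 1 ≤ Nat.find hex := by
    rw [Nat.one_le_iff_ne_zero]
    intro h0
    have := Nat.find_spec hex
    rw [h0, add_zero] at this
    linarith
  refine ⟨Nat.find hex, ⟨h1, Nat.find_spec hex, ?_⟩, ?_⟩
  · have := Nat.find_min hex (m := Nat.find hex - 1) (by omega)
    rw [not_le, ← Nat.add_sub_assoc h1] at this
    exact this
  · rintro m ⟨hm1, hm2, hm3⟩
    refine le_antisymm ?_ (Nat.find_min' hex hm2)
    by_contra hcon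
    have h5 : D.δ (k + m - 1) ≤ D.δ (k + Nat.find hex) := D.δ_strictAnti.antitone (by omega)
    have := Nat.find_spec hex
    linarith

end basic

/-- `m_k`, for `k ∈ Λ`: the unique positive integer with `δ_{k+m_k} ≤ ε_k < δ_{k+m_k-1}`. -/
noncomputable def m (D : CantorData) (k : ℕ) (hk : k ∈ D.Λ) : ℕ := (D.existsUnique_m k hk).choose

lemma m_spec (D : CantorData) (k : ℕ) (hk : k ∈ D.Λ) :
    1 ≤ D.m k hk ∧ D.δ (k + D.m k hk) ≤ D.ε k ∧ D.ε k < D.δ (k + D.m k hk - 1) :=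
  (D.existsUnique_m k hk).choose_spec.1

end CantorData

/-- A matching sequence of positive probability vectors `P_k = (p_{k,1}, …, p_{k,n_k})`, `k ≥ 1`
(the values of `p k i` for other indices are unused). -/
structure MatchingSeq (D : CantorData) where
  p : ℕ → ℕ → ℝ
  pos : ∀ k i, 1 ≤ k → 1 ≤ i → i ≤ D.n k → 0 < p k i
  sum_eq_one : ∀ k, 1 ≤ k → ∑ i ∈ Finset.Icc 1 (D.n k), p k i = 1

/-- `μ` is a probability measure on `E` with `μ (I_{wi}) = p_{k,i} μ (I_w)` for every word `w` of
length `k - 1` and every `1 ≤ i ≤ n_k`, `k ≥ 1`. -/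
def MatchingSeq.Determines {D : CantorData} (P : MatchingSeq D) (μ : Measure D.cantorSet) : Prop :=
  IsProbabilityMeasure μ ∧ ∀ (k : ℕ) (w : ℕ → ℕ), D.IsWord (k + 1) w →
    μ (D.piece w (k + 1)) = ENNReal.ofReal (P.p (k + 1) (w (k + 1))) * μ (D.piece w k)

namespace CantorData

section code

variable (D : CantorData)

lemma IsWord.mono {D : CantorData} {k l : ℕ} {w : ℕ → ℕ} (h : D.IsWord l w) (hkl : k ≤ l) :
    D.IsWord k w := fun j h1 h2 => h j h1 (h2.trans hkl)

lemma leftEnd_congr {w v : ℕ → ℕ} : ∀ k : ℕ, (∀ j, 1 ≤ j → j ≤ k → w j = v j) →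
    D.leftEnd w k = D.leftEnd v k
  | 0, _ => rfl
  | k + 1, h => by
    rw [leftEnd, leftEnd, leftEnd_congr k fun j h1 h2 => h j h1 (by omega),
      h (k + 1) (by omega) le_rfl]

lemma component_congr {w v : ℕ → ℕ} {k : ℕ} (h : ∀ j, 1 ≤ j → j ≤ k → w j = v j) :
    D.component w k = D.component v k := by
  unfold component
  rw [D.leftEnd_congr k h]

lemma step_bounds {w : ℕ → ℕ} {k : ℕ} (h : D.IsWord (k + 1) w) :
    D.leftEnd w k ≤ D.leftEnd w (k + 1) ∧
    D.leftEnd w (k + 1) + D.δ (k + 1) ≤ D.leftEnd w k + D.δ k := by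
  obtain ⟨h1, h2⟩ := h (k + 1) (by omega) le_rfl
  have h1' : (1 : ℝ) ≤ w (k + 1) := by exact_mod_cast h1
  have h2' : (w (k + 1) : ℝ) ≤ D.n (k + 1) := by exact_mod_cast h2
  have hd := D.δ_pos (k + 1)
  have he := D.ε_pos (k + 1) (by omega)
  have hf := D.fill k
  rw [leftEnd]
  constructor <;> nlinarith

lemma component_succ_subset {w : ℕ → ℕ} {k : ℕ} (h : D.IsWord (k + 1) w) :
    D.component w (k + 1) ⊆ D.component w k :=
  Set.Icc_subset_Icc (D.step_bounds h).1 (D.step_bounds h).2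

lemma component_anti {w : ℕ → ℕ} {k l : ℕ} (hkl : k ≤ l) (h : D.IsWord l w) :
    D.component w l ⊆ D.component w k := by
  induction l, hkl using Nat.le_induction with
  | base => exact subset_rfl
  | succ l hl ih => exact (D.component_succ_subset h).trans (ih (h.mono (by omega)))

lemma eq_of_mem {w v : ℕ → ℕ} {x : ℝ} : ∀ k : ℕ, D.IsWord k w → D.IsWord k v →
    x ∈ D.component w k → x ∈ D.component v k → ∀ j, 1 ≤ j → j ≤ k → w j = v j
  | 0, _, _, _, _ => fun j h1 h2 => by omega
  | k + 1, hw, hv, hxw, hxv => by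
    have ih := eq_of_mem k (hw.mono (by omega)) (hv.mono (by omega))
      (D.component_succ_subset hw hxw) (D.component_succ_subset hv hxv)
    intro j h1 h2
    rcases Nat.lt_or_ge k j with hj | hj
    · obtain rfl : j = k + 1 := by omega
      have hl := D.leftEnd_congr k ih
      obtain ⟨a1, a2⟩ := hxw
      obtain ⟨b1, b2⟩ := hxv
      rw [leftEnd] at a1 a2 b1 b2
      have hd := D.δ_pos (k + 1)
      have he := D.ε_pos (k + 1) (by omega)
      rcases lt_trichotomy (w (k + 1)) (v (k + 1)) with hlt | heq | hgt
      · have : (w (k + 1) : ℝ) + 1 ≤ v (k + 1) := by exact_mod_cast hlt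
        nlinarith
      · exact heq
      · have : (v (k + 1) : ℝ) + 1 ≤ w (k + 1) := by exact_mod_cast hgt
        nlinarith
    · exact ih j h1 hj

/-- The digits of `ω`, forced into the admissible ranges. -/
def clamp (ω : ℕ → ℕ) (j : ℕ) : ℕ := max 1 (min (ω j) (D.n j))

lemma clamp_isWord (ω : ℕ → ℕ) (k : ℕ) : D.IsWord k (D.clamp ω) := by
  intro j h1 _
  have := D.two_le j h1
  unfold clamp
  omega

/-- The point of `E` with a given sequence of digits. -/
noncomputable def codeReal (ω : ℕ → ℕ) : ℝ := ⨆ k, D.leftEnd (D.clamp ω) k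

lemma leftEnd_mono (ω : ℕ → ℕ) : Monotone (D.leftEnd (D.clamp ω)) :=
  monotone_nat_of_le_succ fun k => (D.step_bounds (D.clamp_isWord ω (k + 1))).1

lemma rightEnd_anti (ω : ℕ → ℕ) : Antitone fun k => D.leftEnd (D.clamp ω) k + D.δ k :=
  antitone_nat_of_succ_le fun k => (D.step_bounds (D.clamp_isWord ω (k + 1))).2

lemma leftEnd_le_rightEnd (ω : ℕ → ℕ) (k l : ℕ) :
    D.leftEnd (D.clamp ω) l ≤ D.leftEnd (D.clamp ω) k + D.δ k := by
  have h1 := D.leftEnd_mono ω (le_max_right k l)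
  have h2 := D.rightEnd_anti ω (le_max_left k l)
  have h3 := D.δ_pos (max k l)
  simp only at h2
  linarith

lemma bddAbove_leftEnd (ω : ℕ → ℕ) : BddAbove (Set.range (D.leftEnd (D.clamp ω))) :=
  ⟨_, by rintro _ ⟨l, rfl⟩; exact D.leftEnd_le_rightEnd ω 0 l⟩

lemma codeReal_mem (ω : ℕ → ℕ) (k : ℕ) : D.codeReal ω ∈ D.component (D.clamp ω) k :=
  ⟨le_ciSup (D.bddAbove_leftEnd ω) k, ciSup_le fun l => D.leftEnd_le_rightEnd ω k l⟩

lemma codeReal_mem_cantorSet (ω : ℕ → ℕ) : D.codeReal ω ∈ D.cantorSet :=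
  Set.mem_iInter.2 fun k => Set.mem_iUnion₂.2 ⟨_, D.clamp_isWord ω k, D.codeReal_mem ω k⟩

lemma measurable_clamp (j : ℕ) : Measurable fun ω : ℕ → ℕ => D.clamp ω j :=
  (measurable_from_top (f := fun i : ℕ => max 1 (min i (D.n j)))).comp (measurable_pi_apply j)

lemma measurable_leftEnd : ∀ k : ℕ, Measurable fun ω : ℕ → ℕ => D.leftEnd (D.clamp ω) k
  | 0 => measurable_const
  | k + 1 => (measurable_leftEnd k).add
      (((measurable_from_top (f := fun i : ℕ => (i : ℝ) - 1)).comp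
        (D.measurable_clamp (k + 1))).mul_const _)

lemma measurable_codeReal : Measurable D.codeReal :=
  measurable_of_tendsto_metrizable D.measurable_leftEnd
    (tendsto_pi_nhds.2 fun ω => tendsto_atTop_ciSup (D.leftEnd_mono ω) (D.bddAbove_leftEnd ω))

/-- The coding map onto `E`. -/
noncomputable def code (ω : ℕ → ℕ) : D.cantorSet := ⟨D.codeReal ω, D.codeReal_mem_cantorSet ω⟩

lemma measurable_code : Measurable D.code := D.measurable_codeReal.subtype_mk

lemma measurableSet_piece (w : ℕ → ℕ) (k : ℕ) : MeasurableSet (D.piece w k) :=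
  measurable_subtype_coe measurableSet_Icc

lemma piece_zero (w : ℕ → ℕ) : D.piece w 0 = Set.univ := by
  refine Set.eq_univ_of_forall fun x => ?_
  obtain ⟨v, _, hx⟩ := Set.mem_iUnion₂.1 (Set.mem_iInter.1 x.2 0)
  rw [component_zero] at hx
  show x.1 ∈ D.component w 0
  rwa [component_zero]

lemma code_preimage_piece {w : ℕ → ℕ} {k : ℕ} (hw : D.IsWord k w) :
    D.code ⁻¹' D.piece w k =
      Set.pi (Finset.Icc 1 k : Finset ℕ) fun j => {i : ℕ | max 1 (min i (D.n j)) = w j} := by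
  ext ω
  constructor
  · intro h j hj
    have hj' := Finset.mem_Icc.1 (Finset.mem_coe.1 hj)
    exact D.eq_of_mem k (D.clamp_isWord ω k) hw (D.codeReal_mem ω k) h j hj'.1 hj'.2
  · intro h
    show D.codeReal ω ∈ D.component w k
    rw [← D.component_congr (w := D.clamp ω) (v := w) (k := k)
      fun j h1 h2 => h j (Finset.mem_coe.2 (Finset.mem_Icc.2 ⟨h1, h2⟩))]
    exact D.codeReal_mem ω k

end code

end CantorData

namespace MatchingSeq

variable {D : CantorData} (P : MatchingSeq D)

/-- The distribution of the `k`-th digit (a point mass for the unused digit `0`). -/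
noncomputable def digitLaw (k : ℕ) : Measure ℕ :=
  if k = 0 then Measure.dirac 0
  else ∑ i ∈ Finset.Icc 1 (D.n k), ENNReal.ofReal (P.p k i) • Measure.dirac i

lemma digitLaw_apply (k : ℕ) (hk : 1 ≤ k) (s : Set ℕ) : P.digitLaw k s =
    ∑ i ∈ Finset.Icc 1 (D.n k), ENNReal.ofReal (P.p k i) * s.indicator 1 i := by
  rw [digitLaw, if_neg (by omega), Measure.finsetSum_apply]
  simp

lemma digitLaw_univ (k : ℕ) : P.digitLaw k Set.univ = 1 := by
  rcases Nat.eq_zero_or_pos k with rfl | hk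
  · simp [digitLaw]
  · rw [digitLaw_apply P k hk]
    simp only [Set.indicator_univ, Pi.one_apply, mul_one]
    rw [← ENNReal.ofReal_sum_of_nonneg, P.sum_eq_one k hk, ENNReal.ofReal_one]
    intro i hi
    have := Finset.mem_Icc.1 hi
    exact (P.pos k i hk this.1 this.2).le

instance (k : ℕ) : IsProbabilityMeasure (P.digitLaw k) := ⟨P.digitLaw_univ k⟩

lemma digitLaw_clamp (k a : ℕ) (hk : 1 ≤ k) (h1 : 1 ≤ a) (h2 : a ≤ D.n k) :
    P.digitLaw k {i : ℕ | max 1 (min i (D.n k)) = a} = ENNReal.ofReal (P.p k a) := by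
  classical
  rw [digitLaw_apply P k hk, Finset.sum_eq_single a]
  · have : a ∈ {i : ℕ | max 1 (min i (D.n k)) = a} := by
      simp only [Set.mem_ofPred_eq]; omega
    simp [this]
  · intro i hi hne
    have hi' := Finset.mem_Icc.1 hi
    have : i ∉ {i : ℕ | max 1 (min i (D.n k)) = a} := by
      simp only [Set.mem_ofPred_eq]; omega
    simp [this]
  · intro h
    exact absurd (Finset.mem_Icc.2 ⟨h1, h2⟩) h

/-- The law of the random point of `E` with independent digits. -/
noncomputable def codeLaw : Measure D.cantorSet := (Measure.infinitePi P.digitLaw).map D.code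

lemma codeLaw_piece (k : ℕ) (w : ℕ → ℕ) (hw : D.IsWord k w) :
    P.codeLaw (D.piece w k) = ∏ j ∈ Finset.Icc 1 k, ENNReal.ofReal (P.p j (w j)) := by
  rw [codeLaw, Measure.map_apply D.measurable_code (D.measurableSet_piece w k),
    D.code_preimage_piece hw, Measure.infinitePi_pi]
  · refine Finset.prod_congr rfl fun j hj => ?_
    have hj' := Finset.mem_Icc.1 hj
    have := hw j hj'.1 hj'.2
    exact P.digitLaw_clamp j (w j) hj'.1 this.1 this.2
  · intro j _
    trivial

lemma determines_codeLaw : P.Determines P.codeLaw := by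
  refine ⟨Measure.isProbabilityMeasure_map D.measurable_code.aemeasurable, fun k w hw => ?_⟩
  rw [P.codeLaw_piece _ _ hw, P.codeLaw_piece _ _ (hw.mono (Nat.le_succ k)),
    Finset.prod_Icc_succ_top (by omega), mul_comm]

lemma Determines.piece {P : MatchingSeq D} {μ : Measure D.cantorSet} (h : P.Determines μ)
    (w : ℕ → ℕ) : ∀ k : ℕ, D.IsWord k w →
      μ (D.piece w k) = ∏ j ∈ Finset.Icc 1 k, ENNReal.ofReal (P.p j (w j))
  | 0, _ => by
    have := h.1
    rw [D.piece_zero]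
    simp
  | k + 1, hw => by
    rw [h.2 k w hw, Determines.piece h w k (hw.mono (Nat.le_succ k)),
      Finset.prod_Icc_succ_top (by omega), mul_comm]

/-- The family of all components, as subsets of `E`. -/
def pieces (D : CantorData) : Set (Set D.cantorSet) :=
  {s | ∃ (k : ℕ) (w : ℕ → ℕ), D.IsWord k w ∧ s = D.piece w k}

lemma isPiSystem_pieces : IsPiSystem (pieces D) := by
  have key : ∀ (k l : ℕ) (w v : ℕ → ℕ), k ≤ l → D.IsWord k w → D.IsWord l v →
      (D.piece w k ∩ D.piece v l).Nonempty → D.piece w k ∩ D.piece v l = D.piece v l := by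
    rintro k l w v hkl hw hv ⟨x, hxw, hxv⟩
    have hx := D.component_anti hkl hv hxv
    have he := D.eq_of_mem k hw (hv.mono hkl) hxw hx
    refine Set.inter_eq_right.2 fun y hy => ?_
    show y.1 ∈ D.component w k
    rw [D.component_congr he]
    exact D.component_anti hkl hv hy
  rintro _ ⟨k, w, hw, rfl⟩ _ ⟨l, v, hv, rfl⟩ hne
  rcases le_total k l with h | h
  · exact ⟨l, v, hv, key k l w v h hw hv hne⟩
  · refine ⟨k, w, hw, ?_⟩
    rw [Set.inter_comm] at hne ⊢
    exact key l k v w h hv hw hne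

lemma countable_pieces : (pieces D).Countable := by
  have : pieces D ⊆ Set.range fun q : List ℕ × ℕ => D.piece (fun j => q.1.getD j 0) q.2 := by
    rintro _ ⟨k, w, -, rfl⟩
    refine ⟨((List.range (k + 1)).map w, k), ?_⟩
    simp only [CantorData.piece]
    rw [D.component_congr (v := w)]
    intro j _ h2
    have hlt : j < k + 1 := by omega
    simp [List.getD, hlt]
  exact (Set.countable_range _).mono this

lemma generateFrom_pieces :
    (inferInstance : MeasurableSpace D.cantorSet) = MeasurableSpace.generateFrom (pieces D) := by
  apply le_antisymm
  · rw [BorelSpace.measurable_eq (α := D.cantorSet)]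
    refine MeasurableSpace.generateFrom_le fun U hU => ?_
    have hU' : IsOpen U := hU
    have : U = ⋃₀ {s | s ∈ pieces D ∧ s ⊆ U} := by
      refine Set.Subset.antisymm (fun x hx => ?_) (Set.sUnion_subset fun s hs => hs.2)
      obtain ⟨r, hr, hb⟩ := Metric.isOpen_iff.1 hU' x hx
      obtain ⟨k, hk⟩ := (D.δ_tendsto.eventually (gt_mem_nhds hr)).exists
      obtain ⟨w, hw, hxw⟩ := Set.mem_iUnion₂.1 (Set.mem_iInter.1 x.2 k)
      refine ⟨D.piece w k, ⟨⟨k, w, hw, rfl⟩, fun y hy => hb ?_⟩, hxw⟩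
      obtain ⟨a1, a2⟩ := hxw
      obtain ⟨b1, b2⟩ := hy
      rw [Metric.mem_ball, Subtype.dist_eq, Real.dist_eq, abs_lt]
      constructor <;> linarith
    rw [this]
    refine MeasurableSet.sUnion (countable_pieces.mono fun s hs => hs.1) fun s hs => ?_
    exact MeasurableSpace.measurableSet_generateFrom hs.1
  · refine MeasurableSpace.generateFrom_le ?_
    rintro _ ⟨k, w, -, rfl⟩
    exact D.measurableSet_piece w k

/-- A matching sequence of positive probability vectors determines a unique measure on `E`. -/
theorem existsUnique_measure : ∃! μ : Measure D.cantorSet, P.Determines μ := by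
  refine ⟨P.codeLaw, P.determines_codeLaw, fun ν hν => ?_⟩
  have h0 := hν.1
  have h1 := P.determines_codeLaw.1
  refine ext_of_generate_finite (pieces D) generateFrom_pieces isPiSystem_pieces ?_ (by simp)
  rintro _ ⟨k, w, hw, rfl⟩
  rw [hν.piece w k hw, P.codeLaw_piece k w hw]

/-- `μ_P`: the unique probability measure on `E` with `μ_P (I_{wi}) = p_{k,i} μ_P (I_w)`. -/
noncomputable def measure {D : CantorData} (P : MatchingSeq D) : Measure D.cantorSet :=
  P.existsUnique_measure.choose

lemma determines_measure {D : CantorData} (P : MatchingSeq D) : P.Determines P.measure :=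
  P.existsUnique_measure.choose_spec.1

end MatchingSeq

/-! Two components of level `l` less than `δ_l` apart are siblings' descendants: if their labels
first differ at level `k`, then all later digits of the left one are last digits, all later digits
of the right one are first digits, and `ε_k < δ_l` (`digits_of_close`). With `l = k + t` this forces
`t < m_k`. Their masses share the factor of the common prefix, so their ratio is that of two weights
of level `k` times the ratio of the two products in (b). The criterion thus says that nearby
components of equal level have comparable mass.

Sufficiency. By (a) and the bound on `n_k`, all weights are at least some `c > 0`
(`exists_lower_bound`); with (b), nearby components have comparable mass (`mass_comparable`). A ball
of radius at most `δ_l` meets at most three components of level `l` (`measure_ball_le`), and passing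
two levels down costs only `c ^ 2`.

Necessity. Doubling compares a component containing a small ball with any component inside a fixed
multiple of that ball (`GrowthBound.mass_le`). Suitable centres give lower bounds for first weights
(`first_ge`) and comparisons across a gap, short (`prod_le`) or long (`p_mul_le`). These give upper
bounds of left by right weights only; the reflection `x ↦ 1 - x`, which reverses every weight
vector, supplies the opposite inequalities. -/

namespace CantorData

variable (D : CantorData)

/-! ### Positions of components and their gaps -/

lemma exists_word {x : ℝ} (hx : x ∈ D.cantorSet) (k : ℕ) :
    ∃ w, D.IsWord k w ∧ x ∈ D.component w k := by
  simpa [level] using Set.mem_iUnion₂.1 (Set.mem_iInter.1 hx k)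

lemma leftEnd_mono_of_isWord {w : ℕ → ℕ} {a l : ℕ} (hal : a ≤ l) (hw : D.IsWord l w) :
    D.leftEnd w a ≤ D.leftEnd w l := by
  induction l, hal using Nat.le_induction with
  | base => exact le_rfl
  | succ l hl ih => exact (ih (hw.mono (by omega))).trans (D.step_bounds hw).1

lemma rightEnd_anti_of_isWord {w : ℕ → ℕ} {a l : ℕ} (hal : a ≤ l) (hw : D.IsWord l w) :
    D.leftEnd w l + D.δ l ≤ D.leftEnd w a + D.δ a := by
  induction l, hal using Nat.le_induction with
  | base => exact le_rfl
  | succ l hl ih => exact (D.step_bounds hw).2.trans (ih (hw.mono (by omega)))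

lemma leftEnd_of_ones {w : ℕ → ℕ} {a l : ℕ} (hal : a ≤ l) (h : ∀ j, a < j → j ≤ l → w j = 1) :
    D.leftEnd w l = D.leftEnd w a := by
  induction l, hal using Nat.le_induction with
  | base => rfl
  | succ l hl ih =>
    rw [leftEnd, h (l + 1) (by omega) le_rfl, ih fun j h1 h2 => h j h1 (by omega)]
    simp

lemma rightEnd_of_max {w : ℕ → ℕ} {a l : ℕ} (hal : a ≤ l)
    (h : ∀ j, a < j → j ≤ l → w j = D.n j) :
    D.leftEnd w l + D.δ l = D.leftEnd w a + D.δ a := by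
  induction l, hal using Nat.le_induction with
  | base => rfl
  | succ l hl ih =>
    rw [← ih fun j h1 h2 => h j h1 (by omega), leftEnd, h (l + 1) (by omega) le_rfl]
    linarith [D.fill l]

/-- Components whose labels first differ at level `a + 1` are at least `ε_{a+1}` apart. -/
lemma rightEnd_add_gap_le {u v : ℕ → ℕ} {a : ℕ}
    (heq : ∀ j, 1 ≤ j → j ≤ a → u j = v j) (hlt : u (a + 1) < v (a + 1)) :
    D.leftEnd u (a + 1) + D.δ (a + 1) + D.ε (a + 1) ≤ D.leftEnd v (a + 1) := by
  rw [leftEnd, leftEnd, D.leftEnd_congr a heq]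
  have h1 : (u (a + 1) : ℝ) + 1 ≤ v (a + 1) := by exact_mod_cast hlt
  have := D.δ_pos (a + 1)
  have := D.ε_pos (a + 1) (by omega)
  nlinarith

lemma exists_first_diff {u v : ℕ → ℕ} {l : ℕ} (h : ¬ ∀ j, 1 ≤ j → j ≤ l → u j = v j) :
    ∃ a < l, (∀ j, 1 ≤ j → j ≤ a → u j = v j) ∧ u (a + 1) ≠ v (a + 1) := by
  classical
  have hex : ∃ a, a < l ∧ u (a + 1) ≠ v (a + 1) := by
    push Not at h
    obtain ⟨j, h1, h2, h3⟩ := h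
    exact ⟨j - 1, by omega, by rwa [Nat.sub_add_cancel h1]⟩
  refine ⟨Nat.find hex, (Nat.find_spec hex).1, fun j h1 h2 => ?_, (Nat.find_spec hex).2⟩
  by_contra hne
  refine Nat.find_min hex (m := j - 1) (by omega) ⟨?_, by rwa [Nat.sub_add_cancel h1]⟩
  have := (Nat.find_spec hex).1
  omega

/-- If two components of level `l` are less than `δ_l` apart and their labels first differ at
level `a + 1`, then the left one is labelled by last digits beyond this level, the right one by
first digits, and `ε_{a+1} < δ_l`. -/
lemma digits_of_close {u v : ℕ → ℕ} {a l : ℕ} (hal : a < l) (hu : D.IsWord l u)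
    (hv : D.IsWord l v) (heq : ∀ j, 1 ≤ j → j ≤ a → u j = v j) (hlt : u (a + 1) < v (a + 1))
    (hclose : D.leftEnd v l < D.leftEnd u l + 2 * D.δ l) :
    D.ε (a + 1) < D.δ l ∧ (∀ j, a + 1 < j → j ≤ l → u j = D.n j) ∧
      ∀ j, a + 1 < j → j ≤ l → v j = 1 := by
  have hgap := D.rightEnd_add_gap_le heq hlt
  have hε := D.ε_pos (a + 1) (by omega)
  have hR := D.rightEnd_anti_of_isWord (a := a + 1) hal hu
  have hL := D.leftEnd_mono_of_isWord (a := a + 1) hal hv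
  refine ⟨by linarith, fun j h1 h2 => ?_, fun j h1 h2 => ?_⟩
  -- A digit of `u` short of the last leaves a full component of level `j` to its right, of length
  -- at least `δ_l`, between the two components. Symmetrically for a digit of `v` above 1.
  · by_contra hne
    obtain ⟨i, rfl⟩ : ∃ i, j = i + 1 := ⟨j - 1, by omega⟩
    have hj := (hu (i + 1) (by omega) h2).2
    have hj' : (u (i + 1) : ℝ) + 1 ≤ D.n (i + 1) := by exact_mod_cast (by omega)
    have e1 := D.rightEnd_anti_of_isWord h2 hu
    have e2 := D.rightEnd_anti_of_isWord (a := a + 1) (l := i) (by omega) (hu.mono (by omega))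
    have e3 := D.fill i
    have e4 := D.δ_strictAnti.antitone h2
    have e5 := D.δ_pos (i + 1)
    have e6 := D.ε_pos (i + 1) (by omega)
    rw [leftEnd] at e1
    nlinarith
  · by_contra hne
    obtain ⟨i, rfl⟩ : ∃ i, j = i + 1 := ⟨j - 1, by omega⟩
    have hj := (hv (i + 1) (by omega) h2).1
    have hj' : (2 : ℝ) ≤ v (i + 1) := by exact_mod_cast (by omega)
    have e1 := D.leftEnd_mono_of_isWord h2 hv
    have e2 := D.leftEnd_mono_of_isWord (a := a + 1) (l := i) (by omega) (hv.mono (by omega))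
    have e4 := D.δ_strictAnti.antitone h2
    have e5 := D.δ_pos (i + 1)
    have e6 := D.ε_pos (i + 1) (by omega)
    rw [leftEnd] at e1
    nlinarith

lemma rightEnd_lt_leftEnd {u v : ℕ → ℕ} {a l : ℕ} (hal : a < l) (hu : D.IsWord l u)
    (hv : D.IsWord l v) (heq : ∀ j, 1 ≤ j → j ≤ a → u j = v j) (hlt : u (a + 1) < v (a + 1)) :
    D.leftEnd u l + D.δ l < D.leftEnd v l := by
  have hgap := D.rightEnd_add_gap_le heq hlt
  have hε := D.ε_pos (a + 1) (by omega)
  have hR := D.rightEnd_anti_of_isWord (a := a + 1) hal hu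
  have hL := D.leftEnd_mono_of_isWord (a := a + 1) hal hv
  linarith

lemma trichotomy {u v : ℕ → ℕ} {l : ℕ} (hu : D.IsWord l u) (hv : D.IsWord l v) :
    D.component u l = D.component v l ∨ D.leftEnd u l + D.δ l < D.leftEnd v l ∨
      D.leftEnd v l + D.δ l < D.leftEnd u l := by
  by_cases h : ∀ j, 1 ≤ j → j ≤ l → u j = v j
  · exact Or.inl (D.component_congr h)
  · obtain ⟨a, hal, heq, hne⟩ := exists_first_diff h
    rcases lt_or_gt_of_ne hne with hlt | hgt
    · exact Or.inr (Or.inl (D.rightEnd_lt_leftEnd hal hu hv heq hlt))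
    · exact Or.inr (Or.inr (D.rightEnd_lt_leftEnd hal hv hu (fun j h1 h2 => (heq j h1 h2).symm) hgt))

/-- Turns the geometric condition on a gap into the range of `t` in (b): `δ` decreases and
`δ_{k+m_k} ≤ ε_k`. -/
lemma lt_m {k t : ℕ} (hk : k ∈ D.Λ) (h : D.ε k < D.δ (k + t)) : t < D.m k hk := by
  by_contra hcon
  have := D.δ_strictAnti.antitone (show k + D.m k hk ≤ k + t by omega)
  have := (D.m_spec k hk).2.1
  linarith

lemma exists_n_le (hn : BddAbove (D.n '' Set.Ici 1)) : ∃ N : ℕ, 1 ≤ N ∧ ∀ k, 1 ≤ k → D.n k ≤ N := by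
  obtain ⟨N, hN⟩ := hn
  have h : ∀ k, 1 ≤ k → D.n k ≤ N := fun k hk => hN ⟨k, hk, rfl⟩
  exact ⟨N, by have := h 1 le_rfl; have := D.two_le 1 le_rfl; omega, h⟩

end CantorData

/-! ### Sufficiency: comparable masses and measures of balls -/

namespace MatchingSeq

variable {D : CantorData} (P : MatchingSeq D)

/-- The mass of the component of level `k` labelled by `w`. -/
noncomputable def mass (w : ℕ → ℕ) (k : ℕ) : ℝ := ∏ j ∈ Finset.Icc 1 k, P.p j (w j)

lemma mass_succ (w : ℕ → ℕ) (k : ℕ) : P.mass w (k + 1) = P.mass w k * P.p (k + 1) (w (k + 1)) :=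
  Finset.prod_Icc_succ_top (by omega) _

lemma mass_add (w : ℕ → ℕ) (k t : ℕ) :
    P.mass w (k + t) = P.mass w k * ∏ j ∈ Finset.Icc 1 t, P.p (k + j) (w (k + j)) := by
  induction t with
  | zero => simp
  | succ t ih => rw [← add_assoc, mass_succ, ih, Finset.prod_Icc_succ_top (by omega)]; ring_nf

lemma mass_congr {u v : ℕ → ℕ} {k : ℕ} (h : ∀ j, 1 ≤ j → j ≤ k → u j = v j) :
    P.mass u k = P.mass v k :=
  Finset.prod_congr rfl fun j hj => by
    have := Finset.mem_Icc.1 hj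
    rw [h j this.1 this.2]

lemma mass_pos {w : ℕ → ℕ} {k : ℕ} (hw : D.IsWord k w) : 0 < P.mass w k :=
  Finset.prod_pos fun j hj => by
    have := Finset.mem_Icc.1 hj
    exact P.pos j _ this.1 (hw j this.1 this.2).1 (hw j this.1 this.2).2

lemma measure_piece {w : ℕ → ℕ} {k : ℕ} (hw : D.IsWord k w) :
    P.measure (D.piece w k) = ENNReal.ofReal (P.mass w k) := by
  rw [P.determines_measure.piece w k hw, mass, ENNReal.ofReal_prod_of_nonneg]
  intro j hj
  have := Finset.mem_Icc.1 hj
  exact (P.pos j _ this.1 (hw j this.1 this.2).1 (hw j this.1 this.2).2).le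

instance : IsProbabilityMeasure P.measure := P.determines_measure.1

lemma p_le_one {k i : ℕ} (hk : 1 ≤ k) (h1 : 1 ≤ i) (h2 : i ≤ D.n k) : P.p k i ≤ 1 := by
  rw [← P.sum_eq_one k hk]
  refine Finset.single_le_sum (f := P.p k) (fun j hj => ?_) (Finset.mem_Icc.2 ⟨h1, h2⟩)
  have := Finset.mem_Icc.1 hj
  exact (P.pos k j hk this.1 this.2).le

/-- Comparability of neighbouring weights bounds all weights from below. -/
lemma exists_lower_bound {N : ℕ} {C : ℝ} (hN : 1 ≤ N) (hn : ∀ k, 1 ≤ k → D.n k ≤ N) (hC : 1 < C)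
    (ha : ∀ k, 1 ≤ k → ∀ i, 1 ≤ i → i < D.n k →
      C⁻¹ * P.p k i ≤ P.p k (i + 1) ∧ P.p k (i + 1) ≤ C * P.p k i) :
    ∃ c : ℝ, 0 < c ∧ ∀ k i, 1 ≤ k → 1 ≤ i → i ≤ D.n k → c ≤ P.p k i := by
  have hC0 : 0 < C := by linarith
  have hN0 : (0 : ℝ) < N := by exact_mod_cast hN
  -- Chaining (a) over `d` neighbours costs `C ^ d`.
  have key : ∀ k, 1 ≤ k → ∀ i d, 1 ≤ i → i + d ≤ D.n k →
      P.p k (i + d) ≤ C ^ d * P.p k i ∧ P.p k i ≤ C ^ d * P.p k (i + d) := by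
    intro k hk i d hi
    induction d with
    | zero => intro _; simp
    | succ d ih =>
      intro hd
      obtain ⟨h1, h2⟩ := ih (by omega)
      obtain ⟨h3, h4⟩ := ha k hk (i + d) (by omega) (by omega)
      rw [← add_assoc]
      have h5 : P.p k (i + d) ≤ C * P.p k (i + d + 1) := by
        rwa [inv_mul_le_iff₀ hC0] at h3
      have hd0 : 0 < C ^ d := by positivity
      constructor
      · calc P.p k (i + d + 1) ≤ C * P.p k (i + d) := h4
          _ ≤ C * (C ^ d * P.p k i) := by gcongr
          _ = C ^ (d + 1) * P.p k i := by ring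
      · calc P.p k i ≤ C ^ d * P.p k (i + d) := h2
          _ ≤ C ^ d * (C * P.p k (i + d + 1)) := by gcongr
          _ = C ^ (d + 1) * P.p k (i + d + 1) := by ring
  -- At most `N` weights, each at most `C ^ N * p_{k,i}`, add up to 1.
  refine ⟨(N * C ^ N)⁻¹, by positivity, fun k i hk h1 h2 => ?_⟩
  have hp := P.pos k i hk h1 h2
  rw [inv_le_iff_one_le_mul₀ (by positivity)]
  have hpow : ∀ d, d ≤ N → C ^ d * P.p k i ≤ C ^ N * P.p k i := fun d hd =>
    mul_le_mul_of_nonneg_right (pow_le_pow_right₀ hC.le hd) hp.le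
  have hall : ∀ j ∈ Finset.Icc 1 (D.n k), P.p k j ≤ C ^ N * P.p k i := by
    intro j hj
    obtain ⟨hj1, hj2⟩ := Finset.mem_Icc.1 hj
    have := hn k hk
    rcases le_total i j with h | h
    · obtain ⟨d, rfl⟩ := Nat.exists_eq_add_of_le h
      exact (key k hk i d h1 hj2).1.trans (hpow d (by omega))
    · obtain ⟨d, rfl⟩ := Nat.exists_eq_add_of_le h
      exact (key k hk j d hj1 h2).2.trans (hpow d (by omega))
  have hsum := Finset.sum_le_sum hall
  rw [P.sum_eq_one k hk, Finset.sum_const, Nat.card_Icc, nsmul_eq_mul, Nat.add_sub_cancel] at hsum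
  have : (D.n k : ℝ) ≤ N := by exact_mod_cast hn k hk
  have hq : 0 < C ^ N * P.p k i := by positivity
  nlinarith

/-- Under the criterion, components of level `l` less than `δ_l` apart have comparable mass. -/
lemma mass_comparable {C c : ℝ} (hC : 1 < C) (hc : 0 < c)
    (hp : ∀ k i, 1 ≤ k → 1 ≤ i → i ≤ D.n k → c ≤ P.p k i)
    (hb : ∀ (k : ℕ) (hk : k ∈ D.Λ) (t : ℕ), 1 ≤ t → t < D.m k hk →
      C⁻¹ * ∏ j ∈ Finset.Icc 1 t, P.p (k + j) 1
          ≤ ∏ j ∈ Finset.Icc 1 t, P.p (k + j) (D.n (k + j)) ∧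
      ∏ j ∈ Finset.Icc 1 t, P.p (k + j) (D.n (k + j))
          ≤ C * ∏ j ∈ Finset.Icc 1 t, P.p (k + j) 1)
    {u v : ℕ → ℕ} {l : ℕ} (hu : D.IsWord l u) (hv : D.IsWord l v)
    (hlt : D.leftEnd u l + D.δ l < D.leftEnd v l)
    (hclose : D.leftEnd v l < D.leftEnd u l + 2 * D.δ l) :
    P.mass u l ≤ C / c * P.mass v l ∧ P.mass v l ≤ C / c * P.mass u l := by
  have hC0 : 0 < C := by linarith
  have hδ := D.δ_pos l
  have hne : ¬ ∀ j, 1 ≤ j → j ≤ l → u j = v j := fun h => by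
    rw [D.leftEnd_congr l h] at hlt
    linarith
  obtain ⟨a, hal, heq, hne⟩ := CantorData.exists_first_diff hne
  have hlt' : u (a + 1) < v (a + 1) := by
    refine lt_of_le_of_ne (not_lt.1 fun hgt => ?_) hne
    have := D.rightEnd_lt_leftEnd hal hv hu (fun j h1 h2 => (heq j h1 h2).symm) hgt
    linarith
  obtain ⟨hε, hun, hv1⟩ := D.digits_of_close hal hu hv heq hlt' hclose
  obtain ⟨t, rfl⟩ : ∃ t, l = a + 1 + t := ⟨l - (a + 1), by omega⟩
  set Q₁ := ∏ j ∈ Finset.Icc 1 t, P.p (a + 1 + j) 1 with hQ₁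
  set Qn := ∏ j ∈ Finset.Icc 1 t, P.p (a + 1 + j) (D.n (a + 1 + j)) with hQn
  have hQ₁pos : 0 < Q₁ := Finset.prod_pos fun j _ => P.pos _ _ (by omega) le_rfl
    (by have := D.two_le (a + 1 + j) (by omega); omega)
  have hQnpos : 0 < Qn := Finset.prod_pos fun j _ => P.pos _ _ (by omega)
    (by have := D.two_le (a + 1 + j) (by omega); omega) le_rfl
  -- For `t = 0` both products are empty and (b) is not needed.
  have hQ : Q₁ ≤ C * Qn ∧ Qn ≤ C * Q₁ := by
    rcases Nat.eq_zero_or_pos t with rfl | ht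
    · simp [hQ₁, hQn, hC.le]
    · have hk : a + 1 ∈ D.Λ :=
        ⟨by omega, hε.trans_le (D.δ_strictAnti.antitone (by omega))⟩
      obtain ⟨h1, h2⟩ := hb (a + 1) hk t ht (D.lt_m hk hε)
      rw [inv_mul_le_iff₀ hC0] at h1
      exact ⟨h1, h2⟩
  have eu : P.mass u (a + 1 + t) = P.mass v a * P.p (a + 1) (u (a + 1)) * Qn := by
    rw [mass_add, mass_succ, P.mass_congr heq]
    congr 1
    refine Finset.prod_congr rfl fun j hj => ?_
    have := Finset.mem_Icc.1 hj
    rw [hun _ (by omega) (by omega)]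
  have ev : P.mass v (a + 1 + t) = P.mass v a * P.p (a + 1) (v (a + 1)) * Q₁ := by
    rw [mass_add, mass_succ]
    congr 1
    refine Finset.prod_congr rfl fun j hj => ?_
    have := Finset.mem_Icc.1 hj
    rw [hv1 _ (by omega) (by omega)]
  obtain ⟨u1, u2⟩ := hu (a + 1) (by omega) (by omega)
  obtain ⟨v1, v2⟩ := hv (a + 1) (by omega) (by omega)
  have hM : 0 < P.mass v a := P.mass_pos (hv.mono (by omega))
  -- The weights at the level where the labels part satisfy `x ≤ 1 ≤ y / c`, whence the factor `C /
  -- c`.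
  have key : ∀ x y q q' : ℝ, 0 < q → 0 < x → x ≤ 1 → c ≤ y → q' ≤ C * q →
      P.mass v a * x * q' ≤ C / c * (P.mass v a * y * q) := by
    intro x y q q' hq hx hx1 hy hqq
    calc P.mass v a * x * q' ≤ P.mass v a * x * (C * q) := by gcongr
      _ ≤ P.mass v a * 1 * (C * q) := by gcongr
      _ = C / c * (P.mass v a * c * q) := by field_simp
      _ ≤ C / c * (P.mass v a * y * q) := by gcongr
  rw [eu, ev]
  exact ⟨key _ _ _ _ hQ₁pos (P.pos _ _ (by omega) u1 u2) (P.p_le_one (by omega) u1 u2)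
      (hp _ _ (by omega) v1 v2) hQ.2,
    key _ _ _ _ hQnpos (P.pos _ _ (by omega) v1 v2) (P.p_le_one (by omega) v1 v2)
      (hp _ _ (by omega) u1 u2) hQ.1⟩

lemma piece_subset_ball {w : ℕ → ℕ} {k : ℕ} {x : D.cantorSet} {r : ℝ} (hr : D.δ k < r)
    (hx : (x : ℝ) ∈ D.component w k) : D.piece w k ⊆ Metric.ball x r := by
  intro y hy
  obtain ⟨a1, a2⟩ := hx
  obtain ⟨b1, b2⟩ := hy
  rw [Metric.mem_ball, Subtype.dist_eq, Real.dist_eq, abs_lt]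
  constructor <;> linarith

/-- The points of `E` less than `δ_l` to the right of a component of level `l` lie in one
component of level `l`. -/
lemma exists_right_piece {u : ℕ → ℕ} {l : ℕ} (hu : D.IsWord l u) {S : Set D.cantorSet}
    (hne : S.Nonempty)
    (hS : ∀ y ∈ S, D.leftEnd u l + D.δ l < y.1 ∧ y.1 < D.leftEnd u l + 2 * D.δ l) :
    ∃ v, D.IsWord l v ∧ S ⊆ D.piece v l ∧ D.leftEnd u l + D.δ l < D.leftEnd v l ∧
      D.leftEnd v l < D.leftEnd u l + 2 * D.δ l := by
  have right : ∀ y ∈ S, ∀ v, D.IsWord l v → y.1 ∈ D.component v l →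
      D.leftEnd u l + D.δ l < D.leftEnd v l := by
    intro y hy v hv hyv
    have := hS y hy
    have hδ := D.δ_pos l
    rcases D.trichotomy hu hv with h | h | h
    · rw [← h] at hyv
      linarith [hyv.2]
    · exact h
    · linarith [hyv.2]
  obtain ⟨y₀, hy₀⟩ := hne
  obtain ⟨v, hv, hyv⟩ := D.exists_word y₀.2 l
  refine ⟨v, hv, fun y hy => ?_, right y₀ hy₀ v hv hyv, by linarith [hyv.1, hS y₀ hy₀]⟩
  obtain ⟨v', hv', hyv'⟩ := D.exists_word y.2 l
  have h1 := right y₀ hy₀ v hv hyv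
  have h2 := right y hy v' hv' hyv'
  rcases D.trichotomy hv hv' with h | h | h
  · show y.1 ∈ D.component v l
    rwa [h]
  · linarith [hyv'.1, hS y hy]
  · linarith [hyv.1, hS y₀ hy₀]

/-- The points of `E` less than `δ_l` to the left of a component of level `l` lie in one
component of level `l`. -/
lemma exists_left_piece {u : ℕ → ℕ} {l : ℕ} (hu : D.IsWord l u) {S : Set D.cantorSet}
    (hne : S.Nonempty)
    (hS : ∀ y ∈ S, D.leftEnd u l - D.δ l < y.1 ∧ y.1 < D.leftEnd u l) :
    ∃ v, D.IsWord l v ∧ S ⊆ D.piece v l ∧ D.leftEnd v l + D.δ l < D.leftEnd u l ∧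
      D.leftEnd u l < D.leftEnd v l + 2 * D.δ l := by
  have left : ∀ y ∈ S, ∀ v, D.IsWord l v → y.1 ∈ D.component v l →
      D.leftEnd v l + D.δ l < D.leftEnd u l := by
    intro y hy v hv hyv
    have := hS y hy
    have hδ := D.δ_pos l
    rcases D.trichotomy hu hv with h | h | h
    · rw [← h] at hyv
      linarith [hyv.1]
    · linarith [hyv.1]
    · exact h
  obtain ⟨y₀, hy₀⟩ := hne
  obtain ⟨v, hv, hyv⟩ := D.exists_word y₀.2 l
  refine ⟨v, hv, fun y hy => ?_, left y₀ hy₀ v hv hyv, by linarith [hyv.2, hS y₀ hy₀]⟩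
  obtain ⟨v', hv', hyv'⟩ := D.exists_word y.2 l
  have h1 := left y₀ hy₀ v hv hyv
  have h2 := left y hy v' hv' hyv'
  rcases D.trichotomy hv hv' with h | h | h
  · show y.1 ∈ D.component v l
    rwa [h]
  · linarith [hyv.2, hS y₀ hy₀]
  · linarith [hyv'.2, hS y hy]

/-- A bound for the measure of balls of radius at most `δ_l` centred in a component of level `l`. -/
lemma measure_ball_le {B : ℝ} (hB : 0 ≤ B)
    (hcomp : ∀ (l : ℕ) (u v : ℕ → ℕ), D.IsWord l u → D.IsWord l v →
      D.leftEnd u l + D.δ l < D.leftEnd v l → D.leftEnd v l < D.leftEnd u l + 2 * D.δ l →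
      P.mass u l ≤ B * P.mass v l ∧ P.mass v l ≤ B * P.mass u l)
    {u : ℕ → ℕ} {l : ℕ} (hu : D.IsWord l u) {x : D.cantorSet} (hx : x.1 ∈ D.component u l)
    {r : ℝ} (hr : r ≤ D.δ l) :
    P.measure (Metric.ball x r) ≤ ENNReal.ofReal ((1 + 2 * B) * P.mass u l) := by
  have hM := (P.mass_pos hu).le
  -- The parts of the ball to the right and to the left of the component reach less than `δ_l`
  -- beyond it, so each lies in a single neighbouring component.
  set S : Set D.cantorSet := {y ∈ Metric.ball x r | D.leftEnd u l + D.δ l < y.1}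
  set T : Set D.cantorSet := {y ∈ Metric.ball x r | y.1 < D.leftEnd u l}
  have hball : ∀ y ∈ Metric.ball x r, x.1 - D.δ l < y.1 ∧ y.1 < x.1 + D.δ l := by
    intro y hy
    rw [Metric.mem_ball, Subtype.dist_eq, Real.dist_eq, abs_lt] at hy
    constructor <;> linarith
  have hsub : Metric.ball x r ⊆ D.piece u l ∪ S ∪ T := by
    intro y hy
    by_cases h1 : D.leftEnd u l + D.δ l < y.1
    · exact Or.inl (Or.inr ⟨hy, h1⟩)
    by_cases h2 : y.1 < D.leftEnd u l
    · exact Or.inr ⟨hy, h2⟩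
    · exact Or.inl (Or.inl ⟨not_lt.1 h2, not_lt.1 h1⟩)
  have hSm : P.measure S ≤ ENNReal.ofReal (B * P.mass u l) := by
    rcases S.eq_empty_or_nonempty with h | h
    · simp [h]
    · obtain ⟨v, hv, hSv, h1, h2⟩ := exists_right_piece hu h fun y hy =>
        ⟨hy.2, by linarith [(hball y hy.1).2, hx.2]⟩
      calc P.measure S ≤ P.measure (D.piece v l) := measure_mono hSv
        _ = ENNReal.ofReal (P.mass v l) := P.measure_piece hv
        _ ≤ _ := ENNReal.ofReal_le_ofReal (hcomp l u v hu hv h1 h2).2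
  have hTm : P.measure T ≤ ENNReal.ofReal (B * P.mass u l) := by
    rcases T.eq_empty_or_nonempty with h | h
    · simp [h]
    · obtain ⟨v, hv, hTv, h1, h2⟩ := exists_left_piece hu h fun y hy =>
        ⟨by linarith [(hball y hy.1).1, hx.1], hy.2⟩
      calc P.measure T ≤ P.measure (D.piece v l) := measure_mono hTv
        _ = ENNReal.ofReal (P.mass v l) := P.measure_piece hv
        _ ≤ _ := ENNReal.ofReal_le_ofReal (hcomp l v u hv hu h1 h2).1
  calc P.measure (Metric.ball x r) ≤ P.measure (D.piece u l ∪ S ∪ T) := measure_mono hsub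
    _ ≤ P.measure (D.piece u l) + P.measure S + P.measure T :=
      (measure_union_le _ _).trans (add_le_add (measure_union_le _ _) le_rfl)
    _ ≤ ENNReal.ofReal (P.mass u l) + ENNReal.ofReal (B * P.mass u l) +
        ENNReal.ofReal (B * P.mass u l) :=
      add_le_add (add_le_add (P.measure_piece hu).le hSm) hTm
    _ = _ := by
      rw [← ENNReal.ofReal_add hM (by positivity), ← ENNReal.ofReal_add (by positivity)
        (by positivity)]
      ring_nf

theorem isDoubling_of_criterion (hn : BddAbove (D.n '' Set.Ici 1)) {C : ℝ} (hC : 1 < C)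
    (ha : ∀ k, 1 ≤ k → ∀ i, 1 ≤ i → i < D.n k →
      C⁻¹ * P.p k i ≤ P.p k (i + 1) ∧ P.p k (i + 1) ≤ C * P.p k i)
    (hb : ∀ (k : ℕ) (hk : k ∈ D.Λ) (t : ℕ), 1 ≤ t → t < D.m k hk →
      C⁻¹ * ∏ j ∈ Finset.Icc 1 t, P.p (k + j) 1
          ≤ ∏ j ∈ Finset.Icc 1 t, P.p (k + j) (D.n (k + j)) ∧
      ∏ j ∈ Finset.Icc 1 t, P.p (k + j) (D.n (k + j))
          ≤ C * ∏ j ∈ Finset.Icc 1 t, P.p (k + j) 1) :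
    IsDoubling P.measure := by
  obtain ⟨N, hN, hnN⟩ := D.exists_n_le hn
  obtain ⟨c, hc, hp⟩ := P.exists_lower_bound hN hnN hC ha
  have hC0 : 0 < C := by linarith
  have hc1 : c ≤ 1 := (hp 1 1 le_rfl le_rfl (by have := D.two_le 1 le_rfl; omega)).trans
    (P.p_le_one le_rfl le_rfl (by have := D.two_le 1 le_rfl; omega))
  -- `1 + 2 * (C / c)` bounds the ball of radius `2r` by one component; `c * c` is the loss in
  -- descending two levels to a component inside the ball of radius `r`.
  set K : ℝ := (1 + 2 * (C / c)) / (c * c) with hK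
  have hB : 0 < C / c := by positivity
  have hcK : 1 / c ≤ K := by
    rw [hK, div_le_div_iff₀ hc (by positivity)]
    nlinarith [mul_pos hc hB, mul_pos hc hc]
  have hc1' : 1 ≤ 1 / c := by rwa [le_div_iff₀ hc, one_mul]
  have hstep : ∀ w l, D.IsWord (l + 1) w → c * P.mass w l ≤ P.mass w (l + 1) := by
    intro w l hw
    rw [mass_succ, mul_comm]
    have := hw (l + 1) (by omega) le_rfl
    exact mul_le_mul_of_nonneg_left (hp _ _ (by omega) this.1 this.2)
      (P.mass_pos (hw.mono (by omega))).le
  have hcover : ∀ (x : D.cantorSet) (r : ℝ) (k : ℕ) (w : ℕ → ℕ) (A : ℝ), D.IsWord k w →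
      x.1 ∈ D.component w k → D.δ k < r → A ≤ K * P.mass w k →
      ENNReal.ofReal A ≤ ENNReal.ofReal K * P.measure (Metric.ball x r) := by
    intro x r k w A hw hx hr hA
    calc ENNReal.ofReal A ≤ ENNReal.ofReal (K * P.mass w k) := ENNReal.ofReal_le_ofReal hA
      _ = ENNReal.ofReal K * P.measure (D.piece w k) := by
        rw [ENNReal.ofReal_mul (by positivity), P.measure_piece hw]
      _ ≤ _ := by gcongr; exact piece_subset_ball hr hx
  refine ⟨K, by linarith, fun x r hr => ⟨?_, ?_, ?_⟩⟩
  · obtain ⟨k, hk⟩ := (D.δ_tendsto.eventually (gt_mem_nhds hr)).exists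
    obtain ⟨w, hw, hxw⟩ := D.exists_word x.2 k
    calc 0 < P.measure (D.piece w k) := by
          rw [P.measure_piece hw]; exact ENNReal.ofReal_pos.2 (P.mass_pos hw)
      _ ≤ _ := measure_mono (piece_subset_ball (by linarith) hxw)
  · classical
    -- For large `r` the total mass 1 is bound enough; otherwise the first level shorter than `r` is
    -- at least 2.
    by_cases h1 : D.δ 1 < r
    · obtain ⟨w, hw, hxw⟩ := D.exists_word x.2 1
      refine le_trans ?_ (hcover x r 1 w 1 hw hxw h1 ?_)
      · rw [ENNReal.ofReal_one]; exact prob_le_one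
      · have := hstep w 0 hw
        simp only [mass, zero_add, zero_lt_one, Finset.Icc_eq_empty_of_lt, Finset.prod_empty,
          mul_one] at this
        calc (1 : ℝ) = 1 / c * c := by field_simp
          _ ≤ K * P.mass w 1 := mul_le_mul hcK this hc.le (by positivity)
    · have hex : ∃ k, D.δ k < r := (D.δ_tendsto.eventually (gt_mem_nhds hr)).exists
      have hspec := Nat.find_spec hex
      have hge : 2 ≤ Nat.find hex := by
        by_contra hlt
        exact h1 ((D.δ_strictAnti.antitone (by omega)).trans_lt hspec)
      -- Now `δ_{l+2} < r ≤ δ_{l+1}`, and `2 * δ_{l+1} ≤ δ_l` makes `2r` an admissible radius at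
      -- level `l`.
      obtain ⟨l, hl⟩ : ∃ l, Nat.find hex = l + 2 := ⟨Nat.find hex - 2, by omega⟩
      have hr' : r ≤ D.δ (l + 1) := not_lt.1 (Nat.find_min hex (m := l + 1) (by omega))
      rw [hl] at hspec
      obtain ⟨w, hw, hxw⟩ := D.exists_word x.2 (l + 2)
      have hwl : D.IsWord l w := hw.mono (by omega)
      have := D.δ_succ_le l
      refine (P.measure_ball_le hB.le
        (fun l u v hu hv h1 h2 => P.mass_comparable hC hc hp hb hu hv h1 h2) hwl
        (D.component_anti (by omega) hw hxw) (by linarith)).trans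
        (hcover x r (l + 2) w _ hw hxw hspec ?_)
      have e1 := hstep w l (hw.mono (by omega))
      have e2 := hstep w (l + 1) hw
      have e3 : c * (c * P.mass w l) ≤ P.mass w (l + 2) :=
        (mul_le_mul_of_nonneg_left e1 hc.le).trans e2
      calc (1 + 2 * (C / c)) * P.mass w l = K * (c * (c * P.mass w l)) := by
            rw [hK]; field_simp
        _ ≤ _ := mul_le_mul_of_nonneg_left e3 (by positivity)
  · exact ENNReal.mul_lt_top ENNReal.ofReal_lt_top (measure_lt_top _ _)

end MatchingSeq

/-! ### Reflection symmetry and explicit points of the Cantor set -/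

namespace CantorData

variable (D : CantorData)

/-- The digits of the mirror image of a component. -/
def mirror (w : ℕ → ℕ) (j : ℕ) : ℕ := D.n j + 1 - w j

lemma mirror_isWord {D : CantorData} {w : ℕ → ℕ} {k : ℕ} (hw : D.IsWord k w) :
    D.IsWord k (D.mirror w) := fun j h1 h2 => by
  have := hw j h1 h2
  unfold mirror
  omega

lemma leftEnd_mirror (w : ℕ → ℕ) : ∀ k, D.IsWord k w →
    D.leftEnd (D.mirror w) k = 1 - (D.leftEnd w k + D.δ k)
  | 0, _ => by simp [leftEnd, δ_zero]
  | k + 1, hw => by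
    have h := hw (k + 1) (by omega) le_rfl
    rw [leftEnd, leftEnd, leftEnd_mirror w k (hw.mono (by omega)), mirror,
      Nat.cast_sub (by omega), ← D.fill k]
    push_cast
    ring

lemma mem_component_mirror {w : ℕ → ℕ} {k : ℕ} (hw : D.IsWord k w) (x : ℝ) :
    1 - x ∈ D.component w k ↔ x ∈ D.component (D.mirror w) k := by
  unfold component
  rw [D.leftEnd_mirror w k hw, Set.mem_Icc, Set.mem_Icc]
  constructor <;> rintro ⟨h1, h2⟩ <;> constructor <;> linarith

lemma one_sub_mem {x : ℝ} (hx : x ∈ D.cantorSet) : 1 - x ∈ D.cantorSet := by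
  refine Set.mem_iInter.2 fun k => ?_
  obtain ⟨w, hw, hxw⟩ := D.exists_word hx k
  refine Set.mem_iUnion₂.2 ⟨D.mirror w, mirror_isWord hw, ?_⟩
  rw [← D.mem_component_mirror hw]
  simpa using hxw

/-- The reflection `x ↦ 1 - x` of `E`. -/
noncomputable def reflect : D.cantorSet ≃ᵢ D.cantorSet where
  toFun x := ⟨1 - x.1, D.one_sub_mem x.2⟩
  invFun x := ⟨1 - x.1, D.one_sub_mem x.2⟩
  left_inv x := by simp
  right_inv x := by simp
  isometry_toFun := Isometry.of_dist_eq fun x y => by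
    simp only [Subtype.dist_eq, Real.dist_eq]
    rw [show 1 - x.1 - (1 - y.1) = -(x.1 - y.1) by ring, abs_neg]

lemma reflect_preimage_piece {w : ℕ → ℕ} {k : ℕ} (hw : D.IsWord k w) :
    D.reflect ⁻¹' D.piece w k = D.piece (D.mirror w) k :=
  Set.ext fun x => D.mem_component_mirror hw x.1

/-- Continuing a word by first digits keeps the left end fixed. These ends serve as centres of
balls, which must be points of `E`. -/
lemma leftEnd_mem {w : ℕ → ℕ} {k : ℕ} (hw : D.IsWord k w) : D.leftEnd w k ∈ D.cantorSet := by
  refine Set.mem_iInter.2 fun l => Set.mem_iUnion₂.2 ?_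
  rcases le_total l k with h | h
  · refine ⟨w, hw.mono h, D.component_anti h hw ⟨le_rfl, ?_⟩⟩
    linarith [D.δ_pos k]
  · have he : D.leftEnd (fun j => if j ≤ k then w j else 1) l = D.leftEnd w k := by
      rw [D.leftEnd_of_ones h fun j h1 _ => if_neg (by omega)]
      exact D.leftEnd_congr k fun j _ h2 => if_pos h2
    refine ⟨fun j => if j ≤ k then w j else 1, fun j h1 _ => ?_, ?_⟩
    · have := D.two_le j h1
      by_cases hj : j ≤ k
      · simpa [hj] using hw j h1 hj
      · simp only [hj, if_false]; omega
    · rw [component, he]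
      exact ⟨le_rfl, by linarith [D.δ_pos l]⟩

/-- `E` does not meet the gap to the right of a component. -/
lemma le_or_ge_of_mem {y : ℝ} (hy : y ∈ D.cantorSet) {w : ℕ → ℕ} {k : ℕ} (hw : D.IsWord (k + 1) w)
    (hlt : w (k + 1) < D.n (k + 1)) :
    y ≤ D.leftEnd w (k + 1) + D.δ (k + 1) ∨
      D.leftEnd w (k + 1) + D.δ (k + 1) + D.ε (k + 1) ≤ y := by
  by_contra hcon
  push Not at hcon
  obtain ⟨v, hv, hyv⟩ := D.exists_word hy (k + 1)
  have hδ := D.δ_pos (k + 1)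
  have hε := D.ε_pos (k + 1) (by omega)
  have h1 : (w (k + 1) : ℝ) + 1 ≤ D.n (k + 1) := by exact_mod_cast hlt
  have h2 := D.fill k
  have h3 := (D.step_bounds hw).1
  -- The gap lies inside the component of level `k`, as the digit of `w` is not the last. So the
  -- label of `y` agrees with `w` up to level `k`, and only the next digit decides.
  have h4 : y ∈ D.component w k := by
    refine ⟨by linarith, ?_⟩
    rw [leftEnd] at hcon
    nlinarith
  have he := D.eq_of_mem k (hv.mono (by omega)) (hw.mono (by omega))
    (D.component_succ_subset hv hyv) h4
  obtain ⟨b1, b2⟩ := hyv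
  rw [leftEnd, D.leftEnd_congr k he] at b1 b2
  rw [leftEnd] at hcon
  rcases Nat.lt_or_ge (w (k + 1)) (v (k + 1)) with h | h
  · have : (w (k + 1) : ℝ) + 1 ≤ v (k + 1) := by exact_mod_cast h
    nlinarith
  · have : (v (k + 1) : ℝ) ≤ w (k + 1) := by exact_mod_cast h
    nlinarith

/-- The word with last digits after position `k` and first digits before. -/
def lastAfter (k i j : ℕ) : ℕ := if j < k then 1 else if j = k then i else D.n j

lemma lastAfter_isWord {k i : ℕ} (h1 : 1 ≤ i) (h2 : i ≤ D.n k) (l : ℕ) :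
    D.IsWord l (D.lastAfter k i) := fun j hj _ => by
  have := D.two_le j hj
  unfold lastAfter
  split_ifs with h3 h4
  · omega
  · subst h4; exact ⟨h1, h2⟩
  · omega

lemma rightEnd_lastAfter (k i t : ℕ) :
    D.leftEnd (D.lastAfter (k + 1) i) (k + 1 + t) + D.δ (k + 1 + t) =
      ((i : ℝ) - 1) * (D.δ (k + 1) + D.ε (k + 1)) + D.δ (k + 1) := by
  rw [D.rightEnd_of_max (a := k + 1) (by omega), leftEnd,
    D.leftEnd_of_ones (a := 0) (Nat.zero_le k)]
  · simp [lastAfter, leftEnd]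
  · intro j h1 h2
    simp only [lastAfter]
    rw [if_pos (by omega)]
  · intro j h1 h2
    simp only [lastAfter]
    rw [if_neg (by omega), if_neg (by omega)]

/-- Boundedness of `n_k` enters necessity here: a fixed multiple of one step `δ_{k+1} + ε_{k+1}`
exceeds a component of the previous level. -/
lemma mul_sum_gt {N : ℕ} (hnN : ∀ k, 1 ≤ k → D.n k ≤ N) (k : ℕ) :
    D.δ k < N * (D.δ (k + 1) + D.ε (k + 1)) := by
  have h1 : (D.n (k + 1) : ℝ) ≤ N := by exact_mod_cast hnN (k + 1) (by omega)
  have := D.fill k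
  have := D.δ_pos (k + 1)
  have := D.ε_pos (k + 1) (by omega)
  nlinarith

end CantorData

/-! ### Necessity: reversed weights and consequences of doubling -/

namespace MatchingSeq

variable {D : CantorData} (P : MatchingSeq D)

/-- The weights in the order from right to left. -/
def reverse : MatchingSeq D where
  p k i := P.p k (D.n k + 1 - i)
  pos k i hk h1 h2 := P.pos k _ hk (by omega) (by omega)
  sum_eq_one k hk := by
    rw [← P.sum_eq_one k hk]
    refine Finset.sum_bij' (fun i _ => D.n k + 1 - i) (fun i _ => D.n k + 1 - i)
      (fun i hi => ?_) (fun i hi => ?_) (fun i hi => ?_) (fun i hi => ?_) (fun i _ => rfl)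
    all_goals have := Finset.mem_Icc.1 hi
    · exact Finset.mem_Icc.2 (by omega)
    · exact Finset.mem_Icc.2 (by omega)
    · omega
    · omega

lemma reverse_p (k i : ℕ) : P.reverse.p k i = P.p k (D.n k + 1 - i) := rfl

/-- The image of the measure under reflection obeys the recursion with reversed weights, so
uniqueness identifies the two. -/
lemma measure_reverse : P.reverse.measure = P.measure.map D.reflect := by
  have hm : Measurable D.reflect := D.reflect.continuous.measurable
  refine P.reverse.existsUnique_measure.unique P.reverse.determines_measure
    ⟨Measure.isProbabilityMeasure_map hm.aemeasurable, fun k w hw => ?_⟩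
  have hw' : D.IsWord k w := hw.mono (by omega)
  rw [Measure.map_apply hm (D.measurableSet_piece _ _), Measure.map_apply hm
    (D.measurableSet_piece _ _), D.reflect_preimage_piece hw, D.reflect_preimage_piece hw',
    P.determines_measure.2 k _ (CantorData.mirror_isWord hw)]
  rfl

lemma isDoubling_reverse (h : IsDoubling P.measure) : IsDoubling P.reverse.measure := by
  obtain ⟨C, hC, h⟩ := h
  have hball : ∀ x r, P.reverse.measure (Metric.ball x r) =
      P.measure (Metric.ball (D.reflect.symm x) r) := fun x r => by
    rw [measure_reverse, Measure.map_apply D.reflect.continuous.measurable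
      Metric.isOpen_ball.measurableSet,
      D.reflect.preimage_ball]
  exact ⟨C, hC, fun x r hr => by rw [hball, hball]; exact h _ r hr⟩

/-- The measure of a ball grows by at most the factor `A` when its radius is multiplied by `R`. -/
def GrowthBound (R A : ℝ) : Prop := ∀ (x : D.cantorSet) (r : ℝ), 0 < r →
  P.measure (Metric.ball x (R * r)) ≤ ENNReal.ofReal A * P.measure (Metric.ball x r)

lemma exists_growthBound (h : IsDoubling P.measure) (R : ℝ) :
    ∃ A, 1 ≤ A ∧ P.GrowthBound R A := by
  obtain ⟨C, hC, h⟩ := h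
  have hpow : ∀ s : ℕ, P.GrowthBound (2 ^ s) (C ^ s) := by
    intro s
    induction s with
    | zero => intro x r hr; simp
    | succ s ih =>
      intro x r hr
      rw [pow_succ', mul_assoc, pow_succ', ENNReal.ofReal_mul (by linarith), mul_assoc]
      exact (h x (2 ^ s * r) (by positivity)).2.1.trans (by gcongr; exact ih x r hr)
  obtain ⟨s, hs⟩ := pow_unbounded_of_one_lt R (one_lt_two)
  refine ⟨C ^ s, one_le_pow₀ hC, fun x r hr => le_trans ?_ (hpow s x r hr)⟩
  exact measure_mono (Metric.ball_subset_ball (by gcongr))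

/-- The form in which doubling is applied: the small ball lies in one component, the enlarged ball
contains another. -/
lemma GrowthBound.mass_le {P : MatchingSeq D} {R A : ℝ} (h : P.GrowthBound R A) (hA : 1 ≤ A)
    {u v : ℕ → ℕ} {k l : ℕ} (hu : D.IsWord k u) (hv : D.IsWord l v) {x r : ℝ}
    (hx : x ∈ D.cantorSet) (hr : 0 < r)
    (hball : ∀ y ∈ D.cantorSet, x - r < y → y < x + r → y ∈ D.component u k)
    (hl : x - R * r < D.leftEnd v l) (hr' : D.leftEnd v l + D.δ l < x + R * r) :
    P.mass v l ≤ A * P.mass u k := by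
  have h1 : D.piece v l ⊆ Metric.ball (⟨x, hx⟩ : D.cantorSet) (R * r) := by
    rintro y ⟨a1, a2⟩
    rw [Metric.mem_ball, Subtype.dist_eq, Real.dist_eq, abs_lt]
    constructor <;> dsimp only <;> linarith
  have h2 : Metric.ball (⟨x, hx⟩ : D.cantorSet) r ⊆ D.piece u k := by
    intro y hy
    rw [Metric.mem_ball, Subtype.dist_eq, Real.dist_eq, abs_lt] at hy
    dsimp only at hy
    exact hball y.1 y.2 (by linarith) (by linarith)
  have hM := (P.mass_pos hu).le
  rw [← ENNReal.ofReal_le_ofReal_iff (by positivity), ENNReal.ofReal_mul (by linarith),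
    ← P.measure_piece hu, ← P.measure_piece hv]
  calc P.measure (D.piece v l) ≤ _ := measure_mono h1
    _ ≤ _ := h _ r hr
    _ ≤ _ := by gcongr

/-- The ball about 0 whose radius is one step of level `k` sees only the first component of that
level, while `N` times the radius covers the whole first component of level `k - 1`. -/
lemma GrowthBound.first_ge {P : MatchingSeq D} {N : ℕ} {R A : ℝ} (h : P.GrowthBound R A)
    (hA : 1 ≤ A) (hnN : ∀ k, 1 ≤ k → D.n k ≤ N) (hR : N ≤ R) {k : ℕ} (hk : 1 ≤ k) :
    A⁻¹ ≤ P.p k 1 := by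
  obtain ⟨k, rfl⟩ : ∃ i, k = i + 1 := ⟨k - 1, by omega⟩
  have hδ := D.δ_pos (k + 1)
  have hε := D.ε_pos (k + 1) (by omega)
  have hw : ∀ l, D.IsWord l fun _ => 1 := fun l j hj _ =>
    ⟨le_rfl, one_le_two.trans (D.two_le j hj)⟩
  have h0 : ∀ l, D.leftEnd (fun _ => 1) l = 0 := fun l =>
    D.leftEnd_of_ones (Nat.zero_le l) fun _ _ _ => rfl
  have hfill := D.mul_sum_gt hnN k
  have hRr : (N : ℝ) * (D.δ (k + 1) + D.ε (k + 1)) ≤ R * (D.δ (k + 1) + D.ε (k + 1)) := by gcongr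
  have hδk := D.δ_pos k
  have key := h.mass_le (u := fun _ => 1) (v := fun _ => 1) (k := k + 1) (l := k) (x := 0)
    (r := D.δ (k + 1) + D.ε (k + 1)) hA (hw _) (hw _) (by simpa [h0] using D.leftEnd_mem (hw 0))
    (by linarith)
    (fun y hy _ h2 => ?_) (by rw [h0]; linarith) (by rw [h0]; linarith)
  · rw [mass_succ] at key
    have hM := P.mass_pos (hw k)
    rw [inv_le_iff_one_le_mul₀' (by linarith)]
    nlinarith
  · have hn2 := D.two_le (k + 1) (by omega)
    obtain ⟨v, hv, hyv⟩ := D.exists_word hy 0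
    rw [D.component_zero] at hyv
    rw [CantorData.component, h0]
    have := D.le_or_ge_of_mem hy (hw (k + 1)) (by omega)
    rw [h0] at this
    refine ⟨hyv.1, ?_⟩
    rcases this with h | h <;> linarith

lemma mass_lastAfter (k i t : ℕ) : P.mass (D.lastAfter (k + 1) i) (k + 1 + t) =
    P.mass (fun _ => 1) k * P.p (k + 1) i *
      ∏ j ∈ Finset.Icc 1 t, P.p (k + 1 + j) (D.n (k + 1 + j)) := by
  rw [mass_add, mass_succ]
  congr 1
  · congr 1
    · refine P.mass_congr fun j _ h2 => ?_
      simp only [CantorData.lastAfter]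
      rw [if_pos (by omega)]
    · simp [CantorData.lastAfter]
  · refine Finset.prod_congr rfl fun j hj => ?_
    have := Finset.mem_Icc.1 hj
    simp only [CantorData.lastAfter]
    rw [if_neg (by omega), if_neg (by omega)]

/-- Across a gap of level `k + 1` shorter than the components of level `k + 1 + (t + 1)`, the
components of that level have comparable mass. -/
lemma GrowthBound.prod_le {P : MatchingSeq D} {N : ℕ} {R A : ℝ} (h : P.GrowthBound R A)
    (hA : 1 ≤ A) (hnN : ∀ k, 1 ≤ k → D.n k ≤ N) (hR : 2 * N + 1 ≤ R) {k i t : ℕ}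
    (hi : 1 ≤ i) (hin : i < D.n (k + 1)) (hε : D.ε (k + 1) < D.δ (k + 1 + (t + 1))) :
    P.p (k + 1) i * ∏ j ∈ Finset.Icc 1 (t + 1), P.p (k + 1 + j) (D.n (k + 1 + j)) ≤
      A * (P.p (k + 1) (i + 1) * ∏ j ∈ Finset.Icc 1 t, P.p (k + 1 + j) 1) := by
  -- The digit 2 at level `q + 1` moves the centre one step `r` to the right of the left end `a` of
  -- sibling `i + 1`, so that the ball of radius `r` does not cross the short gap on the left.
  set u : ℕ → ℕ := fun j => if j = k + 1 then i + 1 else if j = k + 1 + (t + 1) + 1 then 2 else 1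
    with hu_def
  have hu : ∀ l, D.IsWord l u := fun l j hj _ => by
    have := D.two_le j hj
    simp only [hu_def]
    split_ifs with h3 h4
    · subst h3; omega
    · omega
    · omega
  have hv := D.lastAfter_isWord hi hin.le
  have hvr := D.rightEnd_lastAfter k i (t + 1)
  have hu0 : ∀ l, k + 1 ≤ l → l ≤ k + 1 + (t + 1) →
      D.leftEnd u l = (i : ℝ) * (D.δ (k + 1) + D.ε (k + 1)) := by
    intro l h1 h2
    rw [D.leftEnd_of_ones h1, CantorData.leftEnd, D.leftEnd_of_ones (a := 0) (Nat.zero_le k)]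
    · simp [hu_def, CantorData.leftEnd]
    · intro j h3 h4
      simp only [hu_def]
      rw [if_neg (by omega), if_neg (by omega)]
    · intro j h3 h4
      simp only [hu_def]
      rw [if_neg (by omega), if_neg (by omega)]
  set q := k + 1 + (t + 1) with hq
  set a : ℝ := (i : ℝ) * (D.δ (k + 1) + D.ε (k + 1)) with ha
  set r := D.δ (q + 1) + D.ε (q + 1) with hr
  have hx : D.leftEnd u (q + 1) = a + r := by
    rw [CantorData.leftEnd, hu0 q (by omega) le_rfl]
    have hu2 : u (q + 1) = 2 := by
      simp only [hu_def]
      rw [if_neg (by omega), if_pos trivial]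
    rw [hu2]
    push_cast
    ring
  have hδ := D.δ_pos (q + 1)
  have hδq := D.δ_pos q
  have hε' := D.ε_pos (q + 1) (by omega)
  have hε0 := D.ε_pos (k + 1) (by omega)
  have hfill := D.fill q
  have hn2 : (2 : ℝ) ≤ D.n (q + 1) := by exact_mod_cast D.two_le (q + 1) (by omega)
  have hrδ : r ≤ D.δ q := by nlinarith
  have hNr := D.mul_sum_gt hnN q
  have hδ2 : D.δ q ≤ D.δ (k + 1 + t) * (1 / 2) := D.δ_succ_le (k + 1 + t)
  have hRr : (2 * N + 1) * r ≤ R * r := mul_le_mul_of_nonneg_right hR (by linarith)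
  -- The ball lies in `(a, a + 2r)` and `2r ≤ 2 * δ_q ≤ δ_{k+1+t}`, which is why the right-hand
  -- product has one factor fewer. On the left, `(R - 1) * r ≥ 2 * N * r > 2 * δ_q > δ_q + ε_{k+1}`
  -- reaches past the component of level `q` across the gap.
  have key := h.mass_le (k := k + 1 + t) (l := q) (x := a + r) (r := r) hA (hu _) (hv q)
    (hx ▸ D.leftEnd_mem (hu (q + 1))) (by linarith) (fun y _ h1 h2 => ?_)
    (by nlinarith) (by nlinarith)
  · have hM : 0 < P.mass (fun _ => 1) k := P.mass_pos fun j hj _ =>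
      ⟨le_rfl, by have := D.two_le j hj; omega⟩
    rw [hq, mass_lastAfter, mass_add, mass_succ, P.mass_congr (u := u) (v := fun _ => 1)] at key
    · have hprod : ∏ j ∈ Finset.Icc 1 t, P.p (k + 1 + j) (u (k + 1 + j)) =
          ∏ j ∈ Finset.Icc 1 t, P.p (k + 1 + j) 1 := by
        refine Finset.prod_congr rfl fun j hj => ?_
        have := Finset.mem_Icc.1 hj
        simp only [hu_def]
        rw [if_neg (by omega), if_neg (by omega)]
      have hui : u (k + 1) = i + 1 := if_pos rfl
      rw [hprod, hui] at key
      refine le_of_mul_le_mul_left (a := P.mass (fun _ => 1) k) ?_ hM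
      linarith
    · intro j _ h2
      simp only [hu_def]
      rw [if_neg (by omega), if_neg (by omega)]
  · rw [CantorData.component, hu0 _ (by omega) (by omega)]
    constructor <;> linarith

/-- Neighbouring weights of level `k + 1` are comparable up to the last weight of the next level
if the gaps of level `k + 1` are at least as long as the components of level `k + 2`. -/
lemma GrowthBound.p_mul_le {P : MatchingSeq D} {R A : ℝ} (h : P.GrowthBound R A)
    (hA : 1 ≤ A) (hR : 3 ≤ R) {k i : ℕ}
    (hi : 1 ≤ i) (hin : i + 1 < D.n (k + 1)) (hε : D.δ (k + 1 + 1) ≤ D.ε (k + 1)) :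
    P.p (k + 1) i * P.p (k + 1 + 1) (D.n (k + 1 + 1)) ≤ A * P.p (k + 1) (i + 1) := by
  have hu := D.lastAfter_isWord (k := k + 1) (i := i) hi (by omega)
  have hv := D.lastAfter_isWord (k := k + 1) (i := i + 1) (by omega) hin.le
  have e1 := D.rightEnd_lastAfter k i 0
  have e2 := D.rightEnd_lastAfter k i 1
  have e3 := D.rightEnd_lastAfter k (i + 1) 0
  have hδ := D.δ_pos (k + 1)
  have hδ2 := D.δ_pos (k + 1 + 1)
  have hε0 := D.ε_pos (k + 1) (by omega)
  have hRr : 3 * D.ε (k + 1) ≤ R * D.ε (k + 1) := mul_le_mul_of_nonneg_right hR hε0.le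
  push_cast at e3
  simp only [add_zero] at e1 e3
  -- The radius is the gap length: sibling `i + 1` has gaps on both sides, so the ball stays inside
  -- it. The last component of level `k + 2` in sibling `i` starts at most `2 * ε_{k+1}` to the left
  -- of the centre.
  have key := h.mass_le (k := k + 1) (l := k + 1 + 1) hA (hv _) (hu _)
    (D.leftEnd_mem (hv (k + 1))) hε0 (fun y hy h1 h2 => ?_)
    (by linarith) (by linarith)
  · have hM : 0 < P.mass (fun _ => 1) k := P.mass_pos fun j hj _ =>
      ⟨le_rfl, by have := D.two_le j hj; omega⟩
    have m1 := P.mass_lastAfter k i 1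
    have m2 := P.mass_lastAfter k (i + 1) 0
    simp only [add_zero, Finset.Icc_self, Finset.prod_singleton, zero_lt_one,
      Finset.Icc_eq_empty_of_lt, Finset.prod_empty, mul_one] at m1 m2
    rw [m1, m2] at key
    refine le_of_mul_le_mul_left (a := P.mass (fun _ => 1) k) ?_ hM
    linarith
  · have hd : ∀ i, D.lastAfter (k + 1) i (k + 1) = i := by simp [CantorData.lastAfter]
    have g1 := D.le_or_ge_of_mem hy (hu (k + 1)) (by rw [hd]; omega)
    have g2 := D.le_or_ge_of_mem hy (hv (k + 1)) (by rw [hd]; omega)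
    constructor
    · rcases g1 with g | g <;> linarith
    · rcases g2 with g | g <;> linarith

lemma GrowthBound.last_ge {P : MatchingSeq D} {N : ℕ} {R A : ℝ} (h : P.reverse.GrowthBound R A)
    (hA : 1 ≤ A) (hnN : ∀ k, 1 ≤ k → D.n k ≤ N) (hR : N ≤ R) {k : ℕ} (hk : 1 ≤ k) :
    A⁻¹ ≤ P.p k (D.n k) := by
  simpa [reverse_p] using h.first_ge hA hnN hR hk

/-- The upper bounds for left by right weights in the criterion are necessary. -/
lemma half_criterion_of_isDoubling {N : ℕ} (hnN : ∀ k, 1 ≤ k → D.n k ≤ N)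
    (h : IsDoubling P.measure) :
    ∃ C : ℝ, 1 < C ∧
      (∀ k, 1 ≤ k → ∀ i, 1 ≤ i → i < D.n k → P.p k i ≤ C * P.p k (i + 1)) ∧
      (∀ (k : ℕ) (hk : k ∈ D.Λ) (t : ℕ), 1 ≤ t → t < D.m k hk →
        ∏ j ∈ Finset.Icc 1 t, P.p (k + j) (D.n (k + j))
          ≤ C * ∏ j ∈ Finset.Icc 1 t, P.p (k + j) 1) := by
  obtain ⟨A, hA, hg⟩ := P.exists_growthBound h (2 * N + 1)
  obtain ⟨A', hA', hg'⟩ := P.reverse.exists_growthBound (P.isDoubling_reverse h) (2 * N + 1)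
  have hA0 : 0 < A := by linarith
  have hA0' : 0 < A' := by linarith
  have hN : (1 : ℝ) ≤ N := by
    exact_mod_cast (by have := D.two_le 1 le_rfl; have := hnN 1 le_rfl; omega : 1 ≤ N)
  have hfirst : ∀ k, 1 ≤ k → 1 ≤ A * P.p k 1 := fun k hk => by
    have := hg.first_ge hA hnN (by linarith) hk
    rwa [inv_le_iff_one_le_mul₀' hA0] at this
  have hlast : ∀ k, 1 ≤ k → 1 ≤ A' * P.p k (D.n k) := fun k hk => by
    have := hg'.last_ge hA' hnN (by linarith) hk
    rwa [inv_le_iff_one_le_mul₀' hA0'] at this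
  have hpos : 0 < A * A * A := by positivity
  have hpos' : 0 < A * A' := by positivity
  have hA'A : A * A' ≤ A * A * A + A * A' + 1 := by linarith
  -- `A * A'` serves (a), `A * A * A` serves (b), and 1 makes the constant exceed 1.
  refine ⟨A * A * A + A * A' + 1, by linarith, ?_, ?_⟩
  · intro k hk i hi hin
    obtain ⟨k, rfl⟩ : ∃ i, k = i + 1 := ⟨k - 1, by omega⟩
    have hp := P.pos (k + 1) i hk hi hin.le
    have hp' := P.pos (k + 1) (i + 1) hk (by omega) hin
    suffices hs : P.p (k + 1) i ≤ A * A' * P.p (k + 1) (i + 1) from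
      hs.trans (mul_le_mul_of_nonneg_right hA'A hp'.le)
    have hl := hlast (k + 1 + 1) (by omega)
    have hfin : P.p (k + 1) i * P.p (k + 1 + 1) (D.n (k + 1 + 1)) ≤ A * P.p (k + 1) (i + 1) →
        P.p (k + 1) i ≤ A * A' * P.p (k + 1) (i + 1) := fun hle => by
      calc P.p (k + 1) i ≤ P.p (k + 1) i * (A' * P.p (k + 1 + 1) (D.n (k + 1 + 1))) :=
            le_mul_of_one_le_right hp.le hl
        _ = A' * (P.p (k + 1) i * P.p (k + 1 + 1) (D.n (k + 1 + 1))) := by ring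
        _ ≤ A' * (A * P.p (k + 1) (i + 1)) := by gcongr
        _ = _ := by ring
    -- `p_mul_le` needs a gap to the right of sibling `i + 1`. The last pair is settled by the lower
    -- bound for last weights instead.
    rcases Nat.lt_or_ge (i + 1) (D.n (k + 1)) with hlt | hge
    · rcases lt_or_ge (D.ε (k + 1)) (D.δ (k + 1 + 1)) with hε | hε
      · refine hfin ?_
        have := hg.prod_le hA hnN le_rfl (t := 0) hi hin hε
        simpa using this
      · exact hfin (hg.p_mul_le hA (by linarith) hi hlt hε)
    · obtain hi' : i + 1 = D.n (k + 1) := by omega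
      have h1 := P.p_le_one hk hi hin.le
      have h2 := hlast (k + 1) hk
      rw [← hi'] at h2
      calc P.p (k + 1) i ≤ 1 := h1
        _ ≤ A' * P.p (k + 1) (i + 1) := h2
        _ ≤ A * A' * P.p (k + 1) (i + 1) := by
          gcongr
          exact le_mul_of_one_le_left hA0'.le hA
  · intro k hk t ht htm
    obtain ⟨hk1, -⟩ := id hk
    obtain ⟨hm1, -, hm3⟩ := D.m_spec k hk
    have hε : D.ε k < D.δ (k + t) := hm3.trans_le (D.δ_strictAnti.antitone (by omega))
    obtain ⟨k, rfl⟩ : ∃ i, k = i + 1 := ⟨k - 1, by omega⟩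
    obtain ⟨t, rfl⟩ : ∃ i, t = i + 1 := ⟨t - 1, by omega⟩
    have hn2 := D.two_le (k + 1) hk1
    have key := hg.prod_le hA hnN le_rfl le_rfl (by omega) hε
    have hf := hfirst (k + 1) hk1
    have hf' := hfirst (k + 1 + (t + 1)) (by omega)
    have hp2 := P.p_le_one (k := k + 1) (i := 1 + 1) hk1 (by omega) hn2
    rw [Finset.prod_Icc_succ_top (f := fun j => P.p (k + 1 + j) 1) (by omega)]
    set Q := ∏ j ∈ Finset.Icc 1 t, P.p (k + 1 + j) 1
    set Q' := ∏ j ∈ Finset.Icc 1 (t + 1), P.p (k + 1 + j) (D.n (k + 1 + j))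
    have hQ : 0 < Q := Finset.prod_pos fun j _ => P.pos _ _ (by omega) le_rfl
      (by have := D.two_le (k + 1 + j) (by omega); omega)
    have hQ' : 0 < Q' := Finset.prod_pos fun j _ => P.pos _ _ (by omega)
      (by have := D.two_le (k + 1 + j) (by omega); omega) le_rfl
    have hq := P.pos (k + 1 + (t + 1)) 1 (by omega) le_rfl
      (by have := D.two_le (k + 1 + (t + 1)) (by omega); omega)
    -- One factor `A` is `prod_le` across the first gap; the other two remove `p_{k+1,1}` and
    -- restore the missing last factor of the right-hand product.
    calc Q' ≤ A * P.p (k + 1) 1 * Q' := le_mul_of_one_le_left hQ'.le hf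
      _ = A * (P.p (k + 1) 1 * Q') := by ring
      _ ≤ A * (A * (P.p (k + 1) (1 + 1) * Q)) := by gcongr
      _ ≤ A * (A * (1 * Q)) := by gcongr
      _ ≤ A * (A * (1 * Q)) * (A * P.p (k + 1 + (t + 1)) 1) :=
        le_mul_of_one_le_right (by positivity) hf'
      _ = A * A * A * (Q * P.p (k + 1 + (t + 1)) 1) := by ring
      _ ≤ _ := by gcongr; linarith

end MatchingSeq

/-! ### The equivalence -/

theorem corollary1 (D : CantorData) (P : MatchingSeq D)
    (hn : BddAbove (D.n '' Set.Ici 1)) :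
    IsDoubling P.measure ↔
      ∃ C : ℝ, 1 < C ∧
        (∀ k, 1 ≤ k → ∀ i, 1 ≤ i → i < D.n k →
          C⁻¹ * P.p k i ≤ P.p k (i + 1) ∧ P.p k (i + 1) ≤ C * P.p k i) ∧
        (∀ (k : ℕ) (hk : k ∈ D.Λ) (t : ℕ), 1 ≤ t → t < D.m k hk →
          C⁻¹ * ∏ j ∈ Finset.Icc 1 t, P.p (k + j) 1
              ≤ ∏ j ∈ Finset.Icc 1 t, P.p (k + j) (D.n (k + j)) ∧
          ∏ j ∈ Finset.Icc 1 t, P.p (k + j) (D.n (k + j))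
              ≤ C * ∏ j ∈ Finset.Icc 1 t, P.p (k + j) 1) := by
  constructor
  · intro h
    obtain ⟨N, -, hnN⟩ := D.exists_n_le hn
    obtain ⟨C, hC, ha, hb⟩ := P.half_criterion_of_isDoubling hnN h
    obtain ⟨C', hC', ha', hb'⟩ := P.reverse.half_criterion_of_isDoubling hnN
      (P.isDoubling_reverse h)
    have hM : 0 < max C C' := lt_max_of_lt_left (by linarith)
    refine ⟨max C C', lt_max_of_lt_left hC, fun k hk i h1 h2 => ⟨?_, ?_⟩,
      fun k hk t h1 h2 => ⟨?_, ?_⟩⟩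
    · rw [inv_mul_le_iff₀ hM]
      exact (ha k hk i h1 h2).trans
        (mul_le_mul_of_nonneg_right (le_max_left _ _) (P.pos k _ hk (by omega) h2).le)
    -- Reversal sends the pair `n_k - i`, `n_k - i + 1` to `i + 1`, `i`, which flips the inequality.
    · have := ha' k hk (D.n k - i) (by omega) (by omega)
      rw [P.reverse_p, P.reverse_p, show D.n k + 1 - (D.n k - i) = i + 1 by omega,
        show D.n k + 1 - (D.n k - i + 1) = i by omega] at this
      exact this.trans (mul_le_mul_of_nonneg_right (le_max_right _ _) (P.pos k _ hk h1 h2.le).le)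
    · have := hb' k hk t h1 h2
      simp only [P.reverse_p, Nat.add_sub_cancel_left, Nat.add_sub_cancel] at this
      rw [inv_mul_le_iff₀ hM]
      refine this.trans (mul_le_mul_of_nonneg_right (le_max_right _ _)
        (Finset.prod_nonneg fun j hj => (P.pos _ _ ?_ ?_ le_rfl).le))
      · have := (Finset.mem_Icc.1 hj).1
        omega
      · exact one_le_two.trans (D.two_le _ (by have := (Finset.mem_Icc.1 hj).1; omega))
    · refine (hb k hk t h1 h2).trans (mul_le_mul_of_nonneg_right (le_max_left _ _)
        (Finset.prod_nonneg fun j hj => (P.pos _ _ ?_ le_rfl ?_).le))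
      · have := (Finset.mem_Icc.1 hj).1
        omega
      · exact one_le_two.trans (D.two_le _ (by have := (Finset.mem_Icc.1 hj).1; omega))
  · rintro ⟨C, hC, ha, hb⟩
    exact P.isDoubling_of_criterion hn hC ha hb
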